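/- Let $N\ge 2$, let $p,q\ge 0$ with $p+q=1$ and $p\neq 0$, and let $Y=\{y_1<\cdots<y_N\}\subset\mathbb Z$. Consider the $N$-particle asymmetric simple exclusion process on $\mathbb Z$ with initial configuration $Y$: each particle independently attempts a unit jump to the right at rate $p$ and to the left at rate $q$, and an attempted jump takes place exactly when the target site is vacant. Let $x_1(t)<\cdots<x_N(t)$ be the positions of the particles at time $t\ge 0$. For a set $Z=\{z_1<\cdots<z_n\}$ of integers, $x\in\mathbb Z$ and $\xi=(\xi_1,\dots,\xi_n)$ put $$I(x,Z,\xi)=\prod_{1\le i<j\le n}\frac{\xi_j-\xi_i}{p+q\xi_i\xi_j-\xi_i}\;\frac{1-\xi_1\cdots\xi_n}{(1-\xi_1)\cdots(1-\xi_n)}\;\prod_{i=1}^n\Big(\xi_i^{\,x-z_i-1}e^{\varepsilon(\xi_i)t}\Big),\qquad \varepsilon(\xi)=p\,\xi^{-1}+q\,\xi-1 .$$ Let $\mathcal C_r$ be the positively oriented circle with centre $0$ and radius $r$, where $0<r<1$ is such that $p+q\xi\xi'-\xi\ne 0$ whenever $|\xi|,|\xi'|\le r$, and let every differential $d\xi_i$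 include the factor $(2\pi i)^{-1}$. Put $[n]=\frac{p^n-q^n}{p-q}$, understood as $\sum_{i=0}^{n-1}p^iq^{n-1-i}$ when $p=q$. Then for all $x\in\mathbb Z$ and $t\ge 0$ $$\mathbb P(x_2(t)=x)=-q\,[N-1]\,p^{(N-1)(N-2)/2}\int_{\mathcal C_r}\!\!\cdots\int_{\mathcal C_r} I(x,Y,\xi)\,d\xi_1\cdots d\xi_N$$ $$\qquad+\;p^{(N-1)(N-2)/2}\sum_{k=1}^N\Big(\frac qp\Big)^{k-1}\int_{\mathcal C_r}\!\!\cdots\int_{\mathcal C_r} I(x,Y\setminus\{y_k\},\xi)\,d\xi_1\cdots d\xi_{N-1}.$$ -/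

import Mathlib

open MeasureTheory BoundedContinuousFunction
open scoped NNReal

namespace ASEP

/-- Configurations of `N` particles on `ℤ`, listed from left to right: `x₁ < x₂ < ⋯ < x_N`
(the particle `x_{i+1}` has index `i : Fin N`). -/
abbrev Config (N : ℕ) : Type := {X : Fin N → ℤ // StrictMono X}

/-- The site `y` carries no particle of `X`. -/
def Vacant {N : ℕ} (X : Config N) (y : ℤ) : Prop := ∀ j, X.1 j ≠ y

/-- A jump by one step to a vacant site keeps the particles in order. -/
theorem strictMono_update {N : ℕ} (X : Config N) (i : Fin N) (d : ℤ) (hd : d = 1 ∨ d = -1)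
    (h : Vacant X (X.1 i + d)) : StrictMono (Function.update X.1 i (X.1 i + d)) := by
  intro a b hab
  have h1 := X.2 hab
  by_cases ha : a = i
  · have hb : b ≠ i := by rintro rfl; exact absurd ha hab.ne
    subst ha
    rw [Function.update_self, Function.update_of_ne hb]
    have h2 := h b
    rcases hd with rfl | rfl <;> omega
  · by_cases hb : b = i
    · subst hb
      rw [Function.update_self, Function.update_of_ne ha]
      have h2 := h a
      rcases hd with rfl | rfl <;> omega
    · rw [Function.update_of_ne ha, Function.update_of_ne hb]
      exact h1

open Classical in
/-- The exclusion rule: particle `i` attempts a jump by `d = ±1`; it moves if the target site is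
vacant and stays where it is otherwise. -/
noncomputable def jump {N : ℕ} (X : Config N) (i : Fin N) (d : ℤ) (hd : d = 1 ∨ d = -1) :
    Config N :=
  if h : Vacant X (X.1 i + d) then
    ⟨Function.update X.1 i (X.1 i + d), strictMono_update X i d hd h⟩
  else X

/-- The value of the generator of the process on `f` at `X`. Each particle attempts, independently
of the others, a jump to the right at rate `p` and a jump to the left at rate `q`:
`(L f)(X) = ∑ᵢ (p (f(X with i moved right) - f(X)) + q (f(X with i moved left) - f(X)))`. -/
noncomputable def generatorFun {N : ℕ} (p q : ℝ) (f : Config N → ℝ) (X : Config N) : ℝ :=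
  ∑ i : Fin N, (p * (f (jump X i 1 (Or.inl rfl)) - f X)
    + q * (f (jump X i (-1) (Or.inr rfl)) - f X))

theorem abs_generatorFun_le {N : ℕ} (p q : ℝ) (f : Config N →ᵇ ℝ) (X : Config N) :
    ‖generatorFun p q f X‖ ≤ (N * ((|p| + |q|) * 2)) * ‖f‖ := by
  have key : ∀ Z W : Config N, |f Z - f W| ≤ 2 * ‖f‖ := fun Z W => by
    have h1 := f.norm_coe_le_norm Z
    have h2 := f.norm_coe_le_norm W
    rw [Real.norm_eq_abs] at h1 h2
    have h3 := abs_sub (f Z) (f W)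
    linarith
  unfold generatorFun
  refine (norm_sum_le _ _).trans ?_
  have : ∀ i ∈ (Finset.univ : Finset (Fin N)),
      ‖p * (f (jump X i 1 (Or.inl rfl)) - f X) + q * (f (jump X i (-1) (Or.inr rfl)) - f X)‖
        ≤ ((|p| + |q|) * 2) * ‖f‖ := by
    intro i _
    rw [Real.norm_eq_abs]
    refine (abs_add_le _ _).trans ?_
    rw [abs_mul, abs_mul]
    have h1 := mul_le_mul_of_nonneg_left (key (jump X i 1 (Or.inl rfl)) X) (abs_nonneg p)
    have h2 := mul_le_mul_of_nonneg_left (key (jump X i (-1) (Or.inr rfl)) X) (abs_nonneg q)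
    linarith
  refine (Finset.sum_le_sum this).trans (le_of_eq ?_)
  simp
  ring

/-- The generator as a bounded linear operator on the Banach space of bounded functions on
configurations (`Config N` is discrete, so every bounded function is continuous). -/
noncomputable def generator (N : ℕ) (p q : ℝ) : (Config N →ᵇ ℝ) →L[ℝ] (Config N →ᵇ ℝ) :=
  LinearMap.mkContinuous
    { toFun := fun f => BoundedContinuousFunction.ofNormedAddCommGroupDiscrete
        (generatorFun p q f) _ (abs_generatorFun_le p q f)
      map_add' := by
        intro f g
        ext X
        simp only [generatorFun, coe_ofNormedAddCommGroupDiscrete, coe_add, Pi.add_apply,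
          ← Finset.sum_add_distrib]
        exact Finset.sum_congr rfl fun i _ => by ring
      map_smul' := by
        intro c f
        ext X
        simp only [generatorFun, coe_ofNormedAddCommGroupDiscrete, coe_smul, smul_eq_mul,
          RingHom.id_apply, Finset.mul_sum]
        exact Finset.sum_congr rfl fun i _ => by ring }
    (N * ((|p| + |q|) * 2))
    (fun f => (BoundedContinuousFunction.norm_le (by positivity)).2
      (abs_generatorFun_le p q f))

/-- The semigroup `exp (t A)` generated by a bounded operator `A` on a normed space. -/
noncomputable def expSemigroup {E : Type*} [NormedAddCommGroup E] [NormedSpace ℝ E]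
    (A : E →L[ℝ] E) (t : ℝ≥0) : E →L[ℝ] E :=
  NormedSpace.exp ((t : ℝ) • A)

/-- The Markov semigroup `S(t) = exp (t L)` of the process. -/
noncomputable def semigroup (N : ℕ) (p q : ℝ) (t : ℝ≥0) :
    (Config N →ᵇ ℝ) →L[ℝ] (Config N →ᵇ ℝ) :=
  expSemigroup (generator N p q) t

/-- `X` is the `N`-particle asymmetric simple exclusion process with rates `p` (right) and `q`
(left) and initial configuration `Y`: the continuous-time Markov process started at `Y` whose
transition semigroup is `exp (t L)`, i.e.
`𝔼[f(X_{s+t}) | X_u, u ≤ s] = (S(t) f)(X_s)` for all bounded `f`.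
No regularity of the paths is required. -/
structure IsASEP {Ω : Type*} [MeasurableSpace Ω] (μ : Measure Ω) {N : ℕ} (p q : ℝ)
    (Y : Config N) (X : ℝ≥0 → Ω → Config N) : Prop where
  measurable : ∀ t, Measurable (X t)
  initial : ∀ᵐ ω ∂μ, X 0 ω = Y
  markov : ∀ (s t : ℝ≥0) (f : Config N →ᵇ ℝ),
    μ[fun ω => f (X (s + t) ω) | ⨆ u : Set.Iic s, MeasurableSpace.comap (X u) inferInstance]
      =ᵐ[μ] fun ω => semigroup N p q t f (X s ω)

/-- The number `[n] = (pⁿ - qⁿ) / (p - q)`, written as the polynomial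
`∑_{i<n} pⁱ q^{n-1-i}` so that it is also meaningful for `p = q`. -/
noncomputable def bracket (p q : ℝ) (n : ℕ) : ℝ :=
  ∑ i ∈ Finset.range n, p ^ i * q ^ (n - 1 - i)

theorem bracket_eq_div {p q : ℝ} (h : p ≠ q) (n : ℕ) :
    bracket p q n = (p ^ n - q ^ n) / (p - q) := by
  rw [eq_div_iff (sub_ne_zero.2 h), bracket]
  exact (Commute.all p q).geom_sum₂_mul n

/-- `ε(ξ) = p ξ⁻¹ + q ξ - 1`. -/
noncomputable def eps (p q : ℝ) (ξ : ℂ) : ℂ := p * ξ⁻¹ + q * ξ - 1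

/-- The integrand
`I(x,Y,ξ) = ∏_{i<j} (ξ_j - ξ_i)/(p + q ξ_i ξ_j - ξ_i) · (1 - ξ₁⋯ξ_n)/((1-ξ₁)⋯(1-ξ_n))
  · ∏_i ξ_i^{x-y_i-1} e^{ε(ξ_i) t}`. -/
noncomputable def integrand (p q t : ℝ) (x : ℤ) {n : ℕ} (Y : Fin n → ℤ) (ξ : Fin n → ℂ) : ℂ :=
  (∏ i : Fin n, ∏ j ∈ Finset.Ioi i, (ξ j - ξ i) / (p + q * ξ i * ξ j - ξ i))
    * ((1 - ∏ i, ξ i) / ∏ i, (1 - ξ i))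
    * ∏ i, (ξ i ^ (x - Y i - 1) * Complex.exp (eps p q (ξ i) * t))

/-- The `n`-fold integral of `F` over the product of `n` copies of the circle with centre zero and
radius `r`, every differential being `dξ_i / (2πi)`. -/
noncomputable def contourIntegral (r : ℝ) {n : ℕ} (F : (Fin n → ℂ) → ℂ) : ℂ :=
  ((2 * Real.pi * Complex.I) ^ n)⁻¹ * torusIntegral F (fun _ => 0) (fun _ => r)

/-- The configuration `Y ∖ {y_k}`, listed from left to right. -/
def remove {N : ℕ} (Y : Fin N → ℤ) (k : Fin N) (i : Fin (N - 1)) : ℤ :=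
  if (i : ℕ) < k then Y ⟨i, by omega⟩ else Y ⟨i + 1, by omega⟩

/-- The circle with centre zero and radius `r` is an admissible small contour: `0 < r < 1` and the
denominators `p + q ξ ξ' - ξ` do not vanish for `ξ, ξ'` on or inside the circle. -/
def SmallRadius (p q r : ℝ) : Prop :=
  0 < r ∧ r < 1 ∧ ∀ ξ ξ' : ℂ, ‖ξ‖ ≤ r → ‖ξ'‖ ≤ r → (p : ℂ) + q * ξ * ξ' - ξ ≠ 0

end ASEP

/-! Both sides are power series in `t`, and their coefficients agree. The Markov property from time
0 turns the probability into `exp (t L) f` at `Y`, where `f` indicates that the second particle is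
at `x`; the coefficient of `t ^ k / k!` is `L ^ k f (Y)`. Expanding the exponential under the
integrals gives `momentSum p q r x k Y`, the same combination of integrals with `(∑ ε(ξ_i)) ^ k`
inserted.

The equality of coefficients, `iterate_generatorFun_eq_momentSum`, is an induction on `k`. Its step
is the Bethe ansatz. The free generator multiplies the integrand by `∑ ε(ξ_i)`, and `L` coincides
with the free generator on functions that satisfy a boundary condition at adjacent sites
(`sum_jump_eq_freeGenerator`). Each integral satisfies the condition because the defect is
antisymmetric in two of the variables; the sum over removed particles inherits it because
consecutive weights have ratio `q / p`.

For `k = 0`, the `n`-fold integral is `p ^ (-n(n-1)/2)` times the indicator that the leftmost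
particle is at `x` (`contourIntegral_wave_symmFactor`). After the removal of one particle the
leftmost one is `y₂` if `y₁` was removed and `y₁` otherwise. The unwanted terms have total weight `q
[N-1] / p ^ (N-1)`, and the `N`-fold integral cancels them.

The time-zero integral is found by integrating out the last variable `w`
(`circleIntegral_last_variable`). The pole at `w = 1` reproduces the kernel with one variable fewer;
every other pole contributes a function analytic in some `y_i`, which integrates to zero. -/

namespace ASEP

/-! ### Torus integrals: linearity, Fubini, Cauchy, symmetry, exponential series -/

/-- The product of `n` copies of the circle with centre zero and radius `r`. -/
def torus (r : ℝ) (n : ℕ) : Set (Fin n → ℂ) := {ξ | ∀ i, ‖ξ i‖ = r}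

theorem torusMap_mem_torus {r : ℝ} (hr : 0 < r) {n : ℕ} (θ : Fin n → ℝ) :
    torusMap (fun _ => 0) (fun _ => r) θ ∈ torus r n := by
  intro i
  simp [torusMap, Complex.norm_exp_ofReal_mul_I, abs_of_pos hr]

theorem continuous_comp_torusMap {r : ℝ} (hr : 0 < r) {n : ℕ} {F : (Fin n → ℂ) → ℂ}
    (hF : ContinuousOn F (torus r n)) :
    Continuous fun θ : Fin n → ℝ => F (torusMap (fun _ => 0) (fun _ => r) θ) := by
  refine hF.comp_continuous ?_ (torusMap_mem_torus hr)
  unfold torusMap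
  fun_prop

theorem torusIntegrable_of_continuousOn {r : ℝ} (hr : 0 < r) {n : ℕ} {F : (Fin n → ℂ) → ℂ}
    (hF : ContinuousOn F (torus r n)) : TorusIntegrable F (fun _ => 0) (fun _ => r) :=
  (continuous_comp_torusMap hr hF).continuousOn.integrableOn_compact isCompact_Icc

section linearity

variable {r : ℝ} {n : ℕ} {F G : (Fin n → ℂ) → ℂ}

theorem contourIntegral_congr (hr : 0 < r) (h : ∀ ξ ∈ torus r n, F ξ = G ξ) :
    contourIntegral r F = contourIntegral r G := by
  unfold contourIntegral torusIntegral
  congr 2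
  ext θ
  rw [h _ (torusMap_mem_torus hr θ)]

theorem contourIntegral_add (hr : 0 < r) (hF : ContinuousOn F (torus r n))
    (hG : ContinuousOn G (torus r n)) :
    contourIntegral r (fun ξ => F ξ + G ξ) = contourIntegral r F + contourIntegral r G := by
  unfold contourIntegral
  rw [torusIntegral_add (torusIntegrable_of_continuousOn hr hF)
    (torusIntegrable_of_continuousOn hr hG), mul_add]

theorem contourIntegral_sub (hr : 0 < r) (hF : ContinuousOn F (torus r n))
    (hG : ContinuousOn G (torus r n)) :
    contourIntegral r (fun ξ => F ξ - G ξ) = contourIntegral r F - contourIntegral r G := by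
  unfold contourIntegral
  rw [torusIntegral_sub (torusIntegrable_of_continuousOn hr hF)
    (torusIntegrable_of_continuousOn hr hG), mul_sub]

theorem contourIntegral_const_mul (c : ℂ) :
    contourIntegral r (fun ξ => c * F ξ) = c * contourIntegral r F := by
  unfold contourIntegral
  rw [torusIntegral_const_mul]
  ring

theorem contourIntegral_zero : contourIntegral r (fun _ : Fin n → ℂ => (0 : ℂ)) = 0 := by
  simp [contourIntegral, torusIntegral]

theorem contourIntegral_sum {ι : Type*} (hr : 0 < r) (s : Finset ι) {F : ι → (Fin n → ℂ) → ℂ}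
    (hF : ∀ i, ContinuousOn (F i) (torus r n)) :
    contourIntegral r (fun ξ => ∑ i ∈ s, F i ξ) = ∑ i ∈ s, contourIntegral r (F i) := by
  classical
  induction s using Finset.induction_on with
  | empty => simpa using contourIntegral_zero
  | insert a s ha ih =>
    simp only [Finset.sum_insert ha]
    rw [contourIntegral_add hr (hF a) (continuousOn_finsetSum _ fun i _ => hF i), ih]

end linearity

theorem contourIntegral_dim_zero (r : ℝ) (F : (Fin 0 → ℂ) → ℂ) :
    contourIntegral r F = F (fun _ => 0) := by
  simp [contourIntegral]

/-- Fubini with the chosen variable innermost, so that a one-variable contour computation can be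
made with the others held fixed. -/
theorem torusIntegral_eq_inner {n : ℕ} {f : (Fin (n + 1) → ℂ) → ℂ} {c : Fin (n + 1) → ℂ}
    {R : Fin (n + 1) → ℝ} (hf : TorusIntegrable f c R) (i : Fin (n + 1)) :
    torusIntegral f c R =
      torusIntegral (fun y => ∮ x in C(c i, R i), f (i.insertNth x y))
        (c ∘ i.succAbove) (R ∘ i.succAbove) := by
  set e : ℝ × (Fin n → ℝ) ≃ᵐ (Fin (n + 1) → ℝ) :=
    (MeasurableEquiv.piFinSuccAbove (fun _ => ℝ) i).symm
  have hem : MeasurePreserving e :=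
    (volume_preserving_piFinSuccAbove (fun _ : Fin (n + 1) => ℝ) i).symm _
  have heπ : (e ⁻¹' Set.Icc 0 fun _ => 2 * Real.pi)
      = Set.Icc 0 (2 * Real.pi) ×ˢ Set.Icc (0 : Fin n → ℝ) fun _ => 2 * Real.pi :=
    ((Fin.insertNthOrderIso (fun _ => ℝ) i).preimage_Icc _ _).trans (Set.Icc_prod_eq _ _)
  have hint := hf.function_integrable
  rw [← hem.integrableOn_comp_preimage e.measurableEmbedding, heπ] at hint
  rw [torusIntegral, ← hem.map_eq, setIntegral_map_equiv, heπ, Measure.volume_eq_prod,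
    ← Measure.prod_restrict, integral_prod_symm, torusIntegral]
  · refine setIntegral_congr_fun measurableSet_Icc fun Θ _ => ?_
    simp only [circleIntegral_def_Icc]
    rw [← integral_smul]
    refine setIntegral_congr_fun measurableSet_Icc fun θ _ => ?_
    simp +unfoldPartialApp only [e,
      deriv_circleMap, i.prod_univ_succAbove _, smul_smul, torusMap, circleMap_zero]
    simp only [MeasurableEquiv.piFinSuccAbove_symm_apply, i.insertNth_apply_same,
      i.insertNth_apply_succAbove, (· ∘ ·), Fin.insertNthEquiv, Equiv.coe_fn_mk]
    rw [mul_comm]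
    congr 2
    simp only [funext_iff, i.forall_iff_succAbove, circleMap, Fin.insertNth_apply_same,
      Fin.insertNth_apply_succAbove, imp_true_iff, and_self_iff]
  · rw [IntegrableOn, Measure.volume_eq_prod, ← Measure.prod_restrict] at hint
    exact hint

theorem contourIntegral_eq_inner {r : ℝ} (hr : 0 < r) {n : ℕ} {F : (Fin (n + 1) → ℂ) → ℂ}
    (hF : ContinuousOn F (torus r (n + 1))) (i : Fin (n + 1)) :
    contourIntegral r F =
      contourIntegral r fun y => (2 * Real.pi * Complex.I)⁻¹ *
        ∮ x in C(0, r), F (i.insertNth x y) := by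
  rw [contourIntegral_const_mul]
  unfold contourIntegral
  rw [torusIntegral_eq_inner (torusIntegrable_of_continuousOn hr hF) i, pow_succ, mul_inv]
  simp only [Function.comp_def]
  ring

/-- Cauchy's theorem in one of the variables. -/
theorem contourIntegral_eq_zero {r : ℝ} (hr : 0 < r) {n : ℕ} {F : (Fin n → ℂ) → ℂ}
    (hF : ContinuousOn F (torus r n)) (i : Fin n)
    (hd : ∀ ξ ∈ torus r n, ∃ g : ℂ → ℂ, (∀ w, ‖w‖ ≤ r → DifferentiableAt ℂ g w) ∧
      ∀ w, ‖w‖ = r → F (Function.update ξ i w) = g w) :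
    contourIntegral r F = 0 := by
  obtain _ | n := n
  · exact i.elim0
  rw [contourIntegral_eq_inner hr hF i]
  refine (contourIntegral_congr hr (G := fun _ => 0) fun y hy => ?_).trans contourIntegral_zero
  have hy' : i.insertNth (r : ℂ) y ∈ torus r (n + 1) := by
    intro j
    refine i.succAboveCases ?_ (fun j => ?_) j
    · simp [abs_of_pos hr]
    · simpa using hy j
  -- `g` continues `F` from the circle into the disc. `F` itself may have the wrong value at the
  -- origin, where a negative power of zero is set to zero.
  obtain ⟨g, hg, hFg⟩ := hd _ hy'
  have : (∮ x in C(0, r), F (i.insertNth x y)) = ∮ x in C(0, r), g x := by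
    refine circleIntegral.integral_congr hr.le fun w hw => ?_
    rw [← hFg w (by simpa using hw), Fin.update_insertNth]
  rw [this, Complex.circleIntegral_eq_zero_of_differentiable_on_off_countable hr.le
    Set.countable_empty, mul_zero]
  · exact fun w hw => (hg w (by simpa using hw)).continuousAt.continuousWithinAt
  · exact fun w hw => hg w (by simpa using (Metric.ball_subset_closedBall hw.1))

theorem contourIntegral_comp_perm {r : ℝ} {n : ℕ} (F : (Fin n → ℂ) → ℂ)
    (σ : Equiv.Perm (Fin n)) :
    contourIntegral r (fun ξ => F (ξ ∘ σ)) = contourIntegral r F := by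
  unfold contourIntegral torusIntegral
  congr 1
  have hm := volume_measurePreserving_piCongrLeft (fun _ : Fin n => ℝ) σ.symm
  have he : ∀ θ : Fin n → ℝ, MeasurableEquiv.piCongrLeft (fun _ : Fin n => ℝ) σ.symm θ = θ ∘ σ := by
    intro θ
    ext i
    have := MeasurableEquiv.piCongrLeft_apply_apply σ.symm (β := fun _ => ℝ) θ (σ i)
    simpa using this
  symm
  rw [← hm.setIntegral_preimage_emb (MeasurableEquiv.measurableEmbedding _)]
  have hpre : (MeasurableEquiv.piCongrLeft (fun _ : Fin n => ℝ) σ.symm) ⁻¹'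
      (Set.Icc 0 fun _ => 2 * Real.pi) = Set.Icc (0 : Fin n → ℝ) fun _ => 2 * Real.pi := by
    ext θ
    simp only [Set.mem_preimage, he, Set.mem_Icc, Pi.le_def, Function.comp_apply, Pi.zero_apply]
    constructor
    · rintro ⟨h1, h2⟩
      exact ⟨fun i => by simpa using h1 (σ.symm i), fun i => by simpa using h2 (σ.symm i)⟩
    · rintro ⟨h1, h2⟩
      exact ⟨fun i => h1 _, fun i => h2 _⟩
  rw [hpre]
  refine setIntegral_congr_fun measurableSet_Icc fun θ _ => ?_
  simp only [he]
  refine congrArg₂ _ ?_ rfl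
  exact (Equiv.prod_comp σ fun i => (r : ℂ) * Complex.exp (θ i * Complex.I) * Complex.I)

theorem contourIntegral_eq_zero_of_antisymm {r : ℝ} (hr : 0 < r) {n : ℕ} {F : (Fin n → ℂ) → ℂ}
    (σ : Equiv.Perm (Fin n)) (h : ∀ ξ ∈ torus r n, F (ξ ∘ σ) = -F ξ) :
    contourIntegral r F = 0 := by
  have h1 := contourIntegral_comp_perm (r := r) F σ
  rw [contourIntegral_congr hr (G := fun ξ => (-1) * F ξ) (fun ξ hξ => by rw [h ξ hξ]; ring),
    contourIntegral_const_mul] at h1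
  linear_combination (-1 / 2 : ℂ) * h1

theorem isCompact_torus (r : ℝ) (n : ℕ) : IsCompact (torus r n) := by
  have : torus r n = Set.pi Set.univ fun _ => Metric.sphere (0 : ℂ) r := by
    ext; simp [torus]
  rw [this]
  exact isCompact_univ_pi fun _ => isCompact_sphere _ _

/-- `B` and `E` are bounded on the compact torus, so a scalar exponential series dominates the
expansion. -/
theorem hasSum_contourIntegral_exp {r : ℝ} (hr : 0 < r) {n : ℕ} {B E : (Fin n → ℂ) → ℂ}
    (hB : ContinuousOn B (torus r n)) (hE : ContinuousOn E (torus r n)) (t : ℝ) :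
    HasSum (fun k : ℕ => (t : ℂ) ^ k / k.factorial * contourIntegral r (fun ξ => B ξ * E ξ ^ k))
      (contourIntegral r fun ξ => B ξ * Complex.exp (E ξ * t)) := by
  obtain ⟨CB, hCB⟩ := (isCompact_torus r n).exists_bound_of_continuousOn hB
  obtain ⟨CE, hCE⟩ := (isCompact_torus r n).exists_bound_of_continuousOn hE
  have key : ∀ k : ℕ, (t : ℂ) ^ k / k.factorial * contourIntegral r (fun ξ => B ξ * E ξ ^ k)
      = contourIntegral r (fun ξ => B ξ * ((E ξ * t) ^ k / k.factorial)) := by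
    intro k
    rw [← contourIntegral_const_mul]
    congr 1
    ext ξ
    rw [mul_pow]
    ring
  simp only [key]
  unfold contourIntegral
  refine HasSum.mul_left _ ?_
  have hW : ∀ θ : Fin n → ℝ,
      ‖(∏ i, (r : ℂ) * Complex.exp (θ i * Complex.I) * Complex.I : ℂ)‖ = r ^ n := by
    intro θ
    simp [Complex.norm_exp_ofReal_mul_I, abs_of_pos hr]
  refine hasSum_integral_of_dominated_convergence
    (fun k _ => r ^ n * (CB * ((CE * |t|) ^ k / k.factorial))) ?_ ?_ ?_ ?_ ?_
  · intro k
    refine Continuous.aestronglyMeasurable ?_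
    have h1 : Continuous fun θ : Fin n → ℝ =>
        (∏ i, (r : ℂ) * Complex.exp (θ i * Complex.I) * Complex.I : ℂ) := by fun_prop
    refine h1.smul ?_
    exact (continuous_comp_torusMap hr hB).mul
      ((((continuous_comp_torusMap hr hE).mul continuous_const).pow k).div_const _)
  · intro k
    refine Filter.Eventually.of_forall fun θ => ?_
    have hm := torusMap_mem_torus hr θ
    have h0 := (norm_nonneg _).trans (hCB _ hm)
    rw [norm_smul, hW, norm_mul, norm_div, norm_pow, norm_mul, Complex.norm_natCast,
      Complex.norm_real, Real.norm_eq_abs]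
    gcongr
    · exact hCB _ hm
    · exact hCE _ hm
  · exact Filter.Eventually.of_forall fun θ =>
      ((Real.summable_pow_div_factorial _).mul_left _).mul_left _
  · exact continuousOn_const.integrableOn_compact isCompact_Icc
  · refine Filter.Eventually.of_forall fun θ => ?_
    refine HasSum.const_smul _ (HasSum.mul_left _ ?_)
    rw [Complex.exp_eq_exp_ℂ]
    exact NormedSpace.expSeries_div_hasSum_exp _

/-! ### Residues in one variable -/

theorem circleIntegral_zpow_div_linear {r : ℝ} (hr : 0 < r) {a b : ℂ}
    (h : ∀ w : ℂ, ‖w‖ ≤ r → a + b * w ≠ 0) (l : ℕ) :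
    (∮ w in C(0, r), w ^ (-(l : ℤ) - 1) / (a + b * w))
      = 2 * Real.pi * Complex.I * ((-b) ^ l / a ^ (l + 1)) := by
  have ha : a ≠ 0 := by simpa using h 0 (by simpa using hr.le)
  have hne : ∀ w ∈ Metric.sphere (0 : ℂ) r, w ≠ 0 := fun w hw => by
    rintro rfl
    simp [hr.ne] at hw
  have hne' : ∀ w ∈ Metric.sphere (0 : ℂ) r, a + b * w ≠ 0 := fun w hw =>
    h w (by simpa using (Metric.sphere_subset_closedBall hw))
  have hc1 : ∀ k : ℤ, ContinuousOn (fun w : ℂ => a⁻¹ * w ^ k) (Metric.sphere (0 : ℂ) r) :=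
    fun k => continuousOn_const.mul
      (continuousOn_id.zpow₀ k fun w hw => Or.inl (hne w hw))
  have hc2 : ∀ k : ℤ, ContinuousOn (fun w : ℂ => (b / a) * (w ^ k / (a + b * w)))
      (Metric.sphere (0 : ℂ) r) :=
    fun k => continuousOn_const.mul ((continuousOn_id.zpow₀ k fun w hw => Or.inl (hne w hw)).div
      (by fun_prop) hne')
  -- From `1/(a + b w) = 1/a - (b/a) w/(a + b w)`; each use raises the exponent by one until the
  -- integrand is holomorphic.
  have hrec : ∀ k : ℤ, (∮ w in C(0, r), w ^ k / (a + b * w))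
      = a⁻¹ * (∮ w in C(0, r), w ^ k) - b / a * ∮ w in C(0, r), w ^ (k + 1) / (a + b * w) := by
    intro k
    rw [← circleIntegral.integral_const_mul, ← circleIntegral.integral_const_mul,
      ← circleIntegral.integral_sub ((hc1 k).circleIntegrable hr.le)
        ((hc2 (k + 1)).circleIntegrable hr.le)]
    refine circleIntegral.integral_congr hr.le fun w hw => ?_
    have h1 := hne' w hw
    simp only [zpow_add_one₀ (hne w hw)]
    field_simp
    ring
  induction l with
  | zero =>
    rw [hrec]
    have h1 : (∮ w in C(0, r), w ^ (-((0 : ℕ) : ℤ) - 1)) = 2 * Real.pi * Complex.I := by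
      have := circleIntegral.integral_sub_center_inv (0 : ℂ) hr.ne'
      simpa [zpow_neg] using this
    have h2 : (∮ w in C(0, r), w ^ (-((0 : ℕ) : ℤ) - 1 + 1) / (a + b * w)) = 0 := by
      refine Complex.circleIntegral_eq_zero_of_differentiable_on_off_countable hr.le
        Set.countable_empty ?_ ?_
      · simp only [Nat.cast_zero, neg_zero, zero_sub, neg_add_cancel, zpow_zero]
        exact continuousOn_const.div (by fun_prop) fun w hw => h w (by simpa using hw)
      · intro w hw
        simp only [Nat.cast_zero, neg_zero, zero_sub, neg_add_cancel, zpow_zero]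
        exact (differentiableAt_const _).div (by fun_prop)
          (h w (by simpa using Metric.ball_subset_closedBall hw.1))
    rw [h1, h2]
    simp
    ring
  | succ l ih =>
    rw [hrec]
    have h1 : (∮ w in C(0, r), w ^ (-((l + 1 : ℕ) : ℤ) - 1)) = 0 := by
      have := circleIntegral.integral_sub_zpow_of_ne
        (n := (-((l + 1 : ℕ) : ℤ) - 1)) (by omega) 0 0 r
      simpa using this
    have h2 : -((l + 1 : ℕ) : ℤ) - 1 + 1 = -(l : ℤ) - 1 := by push_cast; ring
    rw [h1, h2, ih]
    field_simp
    ring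

/-- For `b ≠ 0` the integrand is `O(w⁻²)` at infinity, so the integral is minus the residue at
`-a/b`, where `w - α j = -(a + b α j)/b`. The induction on `s` splits `w - α c` into two terms, one
with `l` and one with `l + 1`, and covers `b = 0` as well. -/
theorem circleIntegral_prod_sub_zpow_div_linear {ι : Type*} {r : ℝ} (hr : 0 < r) {a b : ℂ}
    (h : ∀ w : ℂ, ‖w‖ ≤ r → a + b * w ≠ 0) (α : ι → ℂ) (s : Finset ι) (l : ℕ) :
    (∮ w in C(0, r), (∏ j ∈ s, (w - α j)) * (w ^ (-((l + s.card : ℕ) : ℤ) - 1) / (a + b * w)))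
      = 2 * Real.pi * Complex.I *
        ((-b) ^ l / a ^ (l + s.card + 1) * ∏ j ∈ s, (a + b * α j)) := by
  classical
  have ha : a ≠ 0 := by simpa using h 0 (by simpa using hr.le)
  have hne : ∀ w ∈ Metric.sphere (0 : ℂ) r, w ≠ 0 := fun w hw => by
    rintro rfl
    simp [hr.ne] at hw
  have hne' : ∀ w ∈ Metric.sphere (0 : ℂ) r, a + b * w ≠ 0 := fun w hw =>
    h w (by simpa using (Metric.sphere_subset_closedBall hw))
  induction s using Finset.induction_on generalizing l with
  | empty => simpa using circleIntegral_zpow_div_linear hr h l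
  | insert c s hc ih =>
    have hcont : ∀ k : ℤ, ContinuousOn
        (fun w : ℂ => (∏ j ∈ s, (w - α j)) * (w ^ k / (a + b * w))) (Metric.sphere (0 : ℂ) r) :=
      fun k => ContinuousOn.mul (by fun_prop)
        ((continuousOn_id.zpow₀ k fun w hw => Or.inl (hne w hw)).div (by fun_prop) hne')
    have hcont' : ∀ k : ℤ, ContinuousOn
        (fun w : ℂ => α c * ((∏ j ∈ s, (w - α j)) * (w ^ k / (a + b * w))))
        (Metric.sphere (0 : ℂ) r) := fun k => continuousOn_const.mul (hcont k)
    have hsplit : (∮ w in C(0, r), (∏ j ∈ insert c s, (w - α j)) *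
          (w ^ (-((l + (insert c s).card : ℕ) : ℤ) - 1) / (a + b * w)))
        = (∮ w in C(0, r), (∏ j ∈ s, (w - α j)) *
            (w ^ (-((l + s.card : ℕ) : ℤ) - 1) / (a + b * w)))
          - α c * ∮ w in C(0, r), (∏ j ∈ s, (w - α j)) *
            (w ^ (-((l + 1 + s.card : ℕ) : ℤ) - 1) / (a + b * w)) := by
      rw [← circleIntegral.integral_const_mul, ← circleIntegral.integral_sub
        ((hcont _).circleIntegrable hr.le)
        ((hcont' _).circleIntegrable hr.le)]
      refine circleIntegral.integral_congr hr.le fun w hw => ?_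
      have e1 : -((l + (insert c s).card : ℕ) : ℤ) - 1 = -((l + 1 + s.card : ℕ) : ℤ) - 1 := by
        rw [Finset.card_insert_of_notMem hc]; push_cast; ring
      have e2 : -((l + s.card : ℕ) : ℤ) - 1 = -((l + 1 + s.card : ℕ) : ℤ) - 1 + 1 := by
        push_cast; ring
      simp only [Finset.prod_insert hc]
      rw [e1, e2, zpow_add_one₀ (hne w hw)]
      ring
    rw [hsplit, ih, ih, Finset.prod_insert hc, Finset.card_insert_of_notMem hc]
    have e3 : l + (s.card + 1) + 1 = (l + s.card + 1) + 1 := by ring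
    have e4 : l + 1 + s.card + 1 = (l + s.card + 1) + 1 := by ring
    rw [e3, e4, pow_succ a (l + s.card + 1), pow_succ (-b) l]
    field_simp
    ring

/-! ### Vandermonde products and partial fractions -/

theorem prod_Ioi_castSucc {M : Type*} [CommMonoid M] {n : ℕ}
    (g : Fin (n + 1) → Fin (n + 1) → M) :
    ∏ i, ∏ j ∈ Finset.Ioi i, g i j
      = (∏ i : Fin n, ∏ j ∈ Finset.Ioi i, g i.castSucc j.castSucc)
        * ∏ i : Fin n, g i.castSucc (Fin.last n) := by
  simp only [← Finset.filter_lt_eq_Ioi, Finset.prod_filter]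
  rw [Fin.prod_univ_castSucc, ← Finset.prod_mul_distrib]
  simp only [Fin.prod_univ_castSucc, Fin.castSucc_lt_castSucc_iff, Fin.castSucc_lt_last, if_true,
    lt_irrefl, if_false, mul_one]
  have : ∀ i : Fin n, ¬ Fin.last n < i.castSucc := fun i => (Fin.castSucc_lt_last i).not_gt
  simp [this]

/-- The Vandermonde product `∏_{i<j} (v_j - v_i)`. -/
def vdm {R : Type*} [CommRing R] {n : ℕ} (v : Fin n → R) : R :=
  ∏ i, ∏ j ∈ Finset.Ioi i, (v j - v i)

/-- Laplace expansion along the last column of a determinant with columns `v ^ 0, …, v ^ t, v ^ t`,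
two of which coincide. -/
theorem sum_pow_mul_vdm_succAbove {R : Type*} [CommRing R] {t : ℕ} (v : Fin (t + 2) → R) :
    ∑ i : Fin (t + 2), (-1) ^ ((i : ℕ) + (t + 1)) * v i ^ t * vdm (v ∘ i.succAbove) = 0 := by
  let A : Matrix (Fin (t + 2)) (Fin (t + 2)) R := fun i j => v i ^ min (j : ℕ) t
  have h0 : A.det = 0 := by
    refine Matrix.det_zero_of_column_eq (i := Fin.last (t + 1)) (j := (Fin.last t).castSucc)
      (Fin.castSucc_lt_last _).ne' fun k => ?_
    simp [A]
  rw [Matrix.det_succ_column A (Fin.last (t + 1))] at h0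
  rw [← h0]
  refine Finset.sum_congr rfl fun i _ => ?_
  have h1 : A.submatrix i.succAbove (Fin.last (t + 1)).succAbove
      = Matrix.vandermonde (v ∘ i.succAbove) := by
    ext a b
    have : min (b : ℕ) t = b := by omega
    change v (i.succAbove a) ^ min ((Fin.last (t + 1)).succAbove b : ℕ) t = _
    simp only [Fin.succAbove_last, Fin.val_castSucc, this, Matrix.vandermonde_apply,
      Function.comp_apply]
  rw [h1, Matrix.det_vandermonde]
  simp [A, vdm]

theorem vdm_snoc {R : Type*} [CommRing R] {n : ℕ} (v : Fin n → R) (w : R) :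
    vdm (Fin.snoc (α := fun _ => R) v w) = vdm v * ∏ j, (w - v j) := by
  unfold vdm
  rw [prod_Ioi_castSucc]
  simp

/-- The coefficients of the partial fraction expansion of `vdm v / ∏ j (p - u * v j)`. -/
def vdmCoeff {R : Type*} [CommRing R] {t : ℕ} (v : Fin (t + 1) → R) (i : Fin (t + 1)) : R :=
  (-1) ^ ((i : ℕ) + t) * vdm (v ∘ i.succAbove)

theorem snoc_comp_castSucc_succAbove {R : Type*} {t : ℕ} (v : Fin (t + 1) → R) (w : R)
    (i : Fin (t + 1)) :
    (Fin.snoc (α := fun _ => R) v w : Fin (t + 2) → R) ∘ i.castSucc.succAbove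
      = Fin.snoc (α := fun _ => R) (v ∘ i.succAbove) w := by
  ext j
  refine Fin.lastCases ?_ (fun j => ?_) j
  · simp
  · rw [Function.comp_apply, Fin.castSucc_succAbove_castSucc]
    simp

/-- The previous identity with the extra node `p / u`: its own term isolates `vdm v`, and in the
other terms the differences `p / u - v j` become the linear factors `p - u * v j`. -/
theorem vdm_mul_pow_eq_sum {t : ℕ} (v : Fin (t + 1) → ℂ) (p : ℂ) {u : ℂ} (hu : u ≠ 0) :
    p ^ t * vdm v
      = ∑ i, vdmCoeff v i * v i ^ t * ∏ j, (p - u * v (i.succAbove j)) := by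
  have h := sum_pow_mul_vdm_succAbove (Fin.snoc (α := fun _ => ℂ) v (p / u))
  rw [Fin.sum_univ_castSucc] at h
  simp only [snoc_comp_castSucc_succAbove, vdm_snoc, Fin.snoc_castSucc, Fin.snoc_last,
    Fin.val_castSucc, Fin.val_last] at h
  have hl : (Fin.snoc (α := fun _ => ℂ) v (p / u) : Fin (t + 2) → ℂ) ∘ (Fin.last (t + 1)).succAbove
      = v := by
    ext j; simp
  rw [hl, div_pow, Even.neg_one_pow ⟨t + 1, rfl⟩] at h
  have h2 : p ^ t * vdm v = - u ^ t * ∑ i : Fin (t + 1), (-1) ^ ((i : ℕ) + (t + 1)) * v i ^ t *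
      (vdm (v ∘ i.succAbove) * ∏ j : Fin t, (p / u - (v ∘ i.succAbove) j)) := by
    have hut : u ^ t ≠ 0 := pow_ne_zero _ hu
    field_simp at h
    field_simp
    linear_combination h
  rw [h2, Finset.mul_sum]
  refine Finset.sum_congr rfl fun i _ => ?_
  have h3 : ∏ j, (p - u * v (i.succAbove j))
      = u ^ t * ∏ j : Fin t, (p / u - (v ∘ i.succAbove) j) := by
    have : ∀ j, p - u * v (i.succAbove j) = u * (p / u - (v ∘ i.succAbove) j) := by
      intro j
      simp only [Function.comp_apply]
      field_simp
    simp only [this, Finset.prod_mul_distrib]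
    simp
  rw [h3, vdmCoeff]
  ring

/-- The numerators are free of `u`, so one set of coefficients serves both `u = 1 - q w` and `u =
p`. -/
theorem vdm_div_prod_eq_sum {t : ℕ} (v : Fin (t + 1) → ℂ) {p : ℂ} (hp : p ≠ 0) {u : ℂ}
    (hu : u ≠ 0) (h : ∀ i, p - u * v i ≠ 0) :
    vdm v / ∏ j, (p - u * v j)
      = (p ^ t)⁻¹ * ∑ i, vdmCoeff v i * v i ^ t / (p - u * v i) := by
  have h1 := vdm_mul_pow_eq_sum v p hu
  have hP : ∏ j, (p - u * v j) ≠ 0 := Finset.prod_ne_zero_iff.2 fun i _ => h i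
  have hpt : p ^ t ≠ 0 := pow_ne_zero _ hp
  rw [div_eq_iff hP, mul_assoc, eq_inv_mul_iff_mul_eq₀ hpt, h1, Finset.sum_mul]
  refine Finset.sum_congr rfl fun i _ => ?_
  rw [Fin.prod_univ_succAbove _ i]
  have := h i
  field_simp

/-! ### Holomorphic factors on the polydisc -/

/-- `G` is holomorphic at every point of the closed polydisc of radius `r`. -/
def HolomorphicOnPolydisc (r : ℝ) {n : ℕ} (G : (Fin n → ℂ) → ℂ) : Prop :=
  ∀ ξ, (∀ i, ‖ξ i‖ ≤ r) → DifferentiableAt ℂ G ξ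

namespace HolomorphicOnPolydisc

variable {r : ℝ} {n : ℕ} {F G : (Fin n → ℂ) → ℂ}

theorem mul (hF : HolomorphicOnPolydisc r F) (hG : HolomorphicOnPolydisc r G) :
    HolomorphicOnPolydisc r fun ξ => F ξ * G ξ :=
  fun ξ hξ => (hF ξ hξ).mul (hG ξ hξ)

theorem inv (hF : HolomorphicOnPolydisc r F) (h0 : ∀ ξ, (∀ i, ‖ξ i‖ ≤ r) → F ξ ≠ 0) :
    HolomorphicOnPolydisc r fun ξ => (F ξ)⁻¹ :=
  fun ξ hξ => (hF ξ hξ).inv (h0 ξ hξ)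

theorem prod {ι : Type*} {s : Finset ι} {F : ι → (Fin n → ℂ) → ℂ}
    (hF : ∀ i ∈ s, HolomorphicOnPolydisc r (F i)) :
    HolomorphicOnPolydisc r fun ξ => ∏ i ∈ s, F i ξ := by
  classical
  induction s using Finset.induction_on with
  | empty => exact fun ξ _ => by simp
  | insert a s ha ih =>
    simp only [Finset.prod_insert ha]
    exact (hF a (Finset.mem_insert_self a s)).mul (ih fun i hi => hF i (Finset.mem_insert_of_mem hi))

theorem of_differentiable (hF : Differentiable ℂ F) : HolomorphicOnPolydisc r F :=
  fun ξ _ => hF ξ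

theorem continuousOn (hF : HolomorphicOnPolydisc r F) : ContinuousOn F (torus r n) :=
  fun ξ hξ => (hF ξ fun i => (hξ i).le).continuousAt.continuousWithinAt

end HolomorphicOnPolydisc

theorem ne_zero_of_mem_torus {r : ℝ} (hr : 0 < r) {n : ℕ} {ξ : Fin n → ℂ} (hξ : ξ ∈ torus r n)
    (i : Fin n) : ξ i ≠ 0 := by
  rw [← norm_ne_zero_iff, hξ i]
  exact hr.ne'

theorem continuousOn_prod_zpow {r : ℝ} (hr : 0 < r) {n : ℕ} (e : Fin n → ℤ) :
    ContinuousOn (fun ξ : Fin n → ℂ => ∏ i, ξ i ^ e i) (torus r n) :=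
  continuousOn_finsetProd _ fun i _ => (continuous_apply i).continuousOn.zpow₀ _ fun _ hξ =>
    Or.inl (ne_zero_of_mem_torus hr hξ i)

/-- The factor `ξ i ^ m` absorbs the pole at `ξ i = 0`, and Cauchy's theorem applies in that
variable. -/
theorem contourIntegral_holomorphic_mul_zpow {r : ℝ} (hr : 0 < r) {n : ℕ}
    {G : (Fin n → ℂ) → ℂ} (hG : HolomorphicOnPolydisc r G) (e : Fin n → ℤ) (i : Fin n) (m : ℕ)
    (hm : 0 ≤ m + e i) :
    contourIntegral r (fun ξ => ξ i ^ m * G ξ * ∏ j, ξ j ^ e j) = 0 := by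
  obtain ⟨k, hk⟩ := Int.eq_ofNat_of_zero_le hm
  refine contourIntegral_eq_zero hr ?_ i fun ξ hξ => ?_
  · exact (((continuous_apply i).pow m).continuousOn.mul hG.continuousOn).mul
      (continuousOn_prod_zpow hr e)
  · refine ⟨fun w => G (Function.update ξ i w) * w ^ k * ∏ j ∈ Finset.univ.erase i, ξ j ^ e j,
      fun w hw => ?_, fun w hw => ?_⟩
    · refine DifferentiableAt.mul (DifferentiableAt.mul ?_ (by fun_prop)) (by fun_prop)
      refine DifferentiableAt.comp w (hG _ fun j => ?_) ?_
      · rcases eq_or_ne j i with rfl | hj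
        · simpa using hw
        · simpa [hj] using (hξ j).le
      · refine differentiableAt_pi.2 fun j => ?_
        rcases eq_or_ne j i with rfl | hj
        · simp
        · simp [hj]
    · have hw0 : w ≠ 0 := by
        rw [← norm_ne_zero_iff, hw]
        exact hr.ne'
      rw [← Finset.mul_prod_erase Finset.univ _ (Finset.mem_univ i)]
      have : ∏ j ∈ Finset.univ.erase i, Function.update ξ i w j ^ e j
          = ∏ j ∈ Finset.univ.erase i, ξ j ^ e j :=
        Finset.prod_congr rfl fun j hj => by
          rw [Function.update_of_ne (Finset.ne_of_mem_erase hj)]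
      rw [this, Function.update_self]
      have h2 : w ^ k = w ^ m * w ^ e i := by
        rw [← zpow_natCast w k, ← zpow_natCast w m, ← zpow_add₀ hw0, hk]
      simp only [h2]
      ring

/-- The reciprocal of the denominator `∏_{i<j} (p + q ξ_i ξ_j - ξ_i)`. -/
noncomputable def pairDenInv (p q : ℝ) {n : ℕ} (ξ : Fin n → ℂ) : ℂ :=
  ∏ i, ∏ j ∈ Finset.Ioi i, ((p : ℂ) + q * ξ i * ξ j - ξ i)⁻¹

theorem differentiable_vdm {n : ℕ} : Differentiable ℂ (vdm : (Fin n → ℂ) → ℂ) := by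
  unfold vdm
  fun_prop

theorem holomorphic_pairDenInv {p q r : ℝ} (hr : SmallRadius p q r) (n : ℕ) :
    HolomorphicOnPolydisc r (pairDenInv p q (n := n)) :=
  .prod fun i _ => .prod fun j _ =>
    .inv (.of_differentiable (by fun_prop)) fun ξ hξ => hr.2.2 _ _ (hξ i) (hξ j)

theorem one_sub_ne_zero {r : ℝ} (hr : r < 1) {w : ℂ} (hw : ‖w‖ ≤ r) : 1 - w ≠ 0 := by
  intro h
  have : w = 1 := by linear_combination -h
  rw [this, norm_one] at hw
  linarith

theorem holomorphic_prod_one_sub_inv {r : ℝ} (hr : r < 1) (n : ℕ) :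
    HolomorphicOnPolydisc r fun ξ : Fin n → ℂ => (∏ i, (1 - ξ i))⁻¹ :=
  .inv (.of_differentiable (by fun_prop)) fun _ hξ =>
    Finset.prod_ne_zero_iff.2 fun i _ => one_sub_ne_zero hr (hξ i)

/-! ### Integrating out the last variable; the time-zero kernel -/

/-- The residue at the pole of `1 / (p + q ξ_i w - ξ_i)` in the last variable `w`. -/
noncomputable def residueTerm (p q : ℝ) {t : ℕ} (l : ℕ) (i : Fin (t + 1))
    (y : Fin (t + 1) → ℂ) : ℂ :=
  ((p : ℂ) ^ t)⁻¹ * vdmCoeff y i * (p * (1 - y i))⁻¹ * (q * (-q) ^ l)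
    * (((p : ℂ) - y i) ^ (l + (t + 1) + 1))⁻¹ * ∏ j, ((p : ℂ) - y i + q * y i * y j)

theorem holomorphic_residueTerm {p q r : ℝ} (hp : p ≠ 0) (hr : SmallRadius p q r) {t : ℕ} (l : ℕ)
    (i : Fin (t + 1)) : HolomorphicOnPolydisc r (residueTerm p q l i) := by
  unfold residueTerm vdmCoeff
  have hv : Differentiable ℂ fun y : Fin (t + 1) → ℂ => vdm (y ∘ i.succAbove) :=
    differentiable_vdm.comp (by unfold Function.comp; fun_prop)
  refine .mul (.mul (.mul (.mul (.of_differentiable (by fun_prop)) (.inv (.of_differentiable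
    (by fun_prop)) fun ξ hξ => ?_)) (.of_differentiable (by fun_prop)))
    (.inv (.of_differentiable (by fun_prop)) fun ξ hξ => ?_)) (.of_differentiable (by fun_prop))
  · exact mul_ne_zero (by exact_mod_cast hp) (one_sub_ne_zero hr.2.1 (hξ i))
  · refine pow_ne_zero _ ?_
    simpa using hr.2.2 (ξ i) 0 (hξ i) (by simpa using hr.1.le)

/-- Since `p + q y_j w - y_j = p - (1 - q w) y_j`, partial fractions with `u = 1 - q w` leave one
such denominator per term. The pole at `w = 1` yields the first summand, the zero of `p - y_i + q
y_i w` the residue terms. Their power of `y_i` collects `t` from the coefficient, one from splitting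
the denominators and `l` from the residue. -/
theorem circleIntegral_last_variable {p q r : ℝ} (hp : 0 ≤ p) (hq : 0 ≤ q) (hpq : p + q = 1)
    (hp0 : p ≠ 0) (hr : SmallRadius p q r) {t : ℕ} (l : ℕ) {y : Fin (t + 1) → ℂ}
    (hy : y ∈ torus r (t + 1)) :
    (2 * Real.pi * Complex.I)⁻¹ * (∮ w in C(0, r),
      vdm y * (∏ j, (w - y j)) * (∏ j, ((p : ℂ) + q * y j * w - y j)⁻¹) * (1 - w)⁻¹
        * w ^ (-((l + (t + 1) : ℕ) : ℤ) - 1))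
      = ((p : ℂ) ^ (t + 1))⁻¹ * vdm y
        + ∑ i, y i ^ (l + (t + 1)) * residueTerm p q l i y := by
  have hr0 := hr.1
  have hpC : (p : ℂ) ≠ 0 := by exact_mod_cast hp0
  have hpqC : (p : ℂ) + q = 1 := by exact_mod_cast hpq
  have hy1 : ∀ i, 1 - y i ≠ 0 := fun i => one_sub_ne_zero hr.2.1 (hy i).le
  have hden : ∀ i (w : ℂ), ‖w‖ ≤ r → ((p : ℂ) - y i) + q * y i * w ≠ 0 := fun i w hw => by
    have := hr.2.2 (y i) w (hy i).le hw
    convert this using 1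
    ring
  have hone : ∀ w : ℂ, ‖w‖ ≤ r → (1 : ℂ) + (-1) * w ≠ 0 := fun w hw => by
    have := one_sub_ne_zero hr.2.1 hw
    convert this using 1
    ring
  have hsph : ∀ w ∈ Metric.sphere (0 : ℂ) r, ‖w‖ ≤ r := fun w hw => by
    simpa using (Metric.sphere_subset_closedBall hw)
  have hne : ∀ w ∈ Metric.sphere (0 : ℂ) r, w ≠ 0 := fun w hw => by
    rintro rfl
    simp [hr0.ne] at hw
  set z : ℤ := -((l + (t + 1) : ℕ) : ℤ) - 1 with hz
  set C : Fin (t + 1) → ℂ := fun i =>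
    ((p : ℂ) ^ t)⁻¹ * vdmCoeff y i * y i ^ t * (p * (1 - y i))⁻¹ with hC
  have hcont : ∀ a b : ℂ, (∀ w : ℂ, ‖w‖ ≤ r → a + b * w ≠ 0) → ContinuousOn
      (fun w : ℂ => (∏ j, (w - y j)) * (w ^ z / (a + b * w))) (Metric.sphere (0 : ℂ) r) :=
    fun a b h => ContinuousOn.mul (by fun_prop)
      ((continuousOn_id.zpow₀ z fun w hw => Or.inl (hne w hw)).div (by fun_prop)
        fun w hw => h w (hsph w hw))
  have hA : ∀ a b : ℂ, (∀ w : ℂ, ‖w‖ ≤ r → a + b * w ≠ 0) →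
      (∮ w in C(0, r), (∏ j, (w - y j)) * (w ^ z / (a + b * w)))
        = 2 * Real.pi * Complex.I *
        ((-b) ^ l / a ^ (l + (t + 1) + 1) * ∏ j, (a + b * y j)) := by
    intro a b h
    have := circleIntegral_prod_sub_zpow_div_linear hr0 h y Finset.univ l
    simpa [hz] using this
  have hsplit : (∮ w in C(0, r),
      vdm y * (∏ j, (w - y j)) * (∏ j, ((p : ℂ) + q * y j * w - y j)⁻¹) * (1 - w)⁻¹ * w ^ z)
      = ∑ i, C i * ((∮ w in C(0, r), (∏ j, (w - y j)) * (w ^ z / (1 + (-1) * w)))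
        + q * y i * ∮ w in C(0, r), (∏ j, (w - y j)) *
          (w ^ z / (((p : ℂ) - y i) + q * y i * w))) := by
    have h1 : ∀ i, C i * ((∮ w in C(0, r), (∏ j, (w - y j)) * (w ^ z / (1 + (-1) * w)))
        + q * y i * ∮ w in C(0, r), (∏ j, (w - y j)) *
          (w ^ z / (((p : ℂ) - y i) + q * y i * w)))
        = ∮ w in C(0, r), C i * ((∏ j, (w - y j)) * (w ^ z / (1 + (-1) * w))
          + q * y i * ((∏ j, (w - y j)) * (w ^ z / (((p : ℂ) - y i) + q * y i * w)))) := by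
      intro i
      have hc := hcont _ _ (hden i)
      have hc' : ContinuousOn (fun w : ℂ => q * y i * ((∏ j, (w - y j)) *
          (w ^ z / (((p : ℂ) - y i) + q * y i * w)))) (Metric.sphere (0 : ℂ) r) :=
        continuousOn_const.mul hc
      rw [circleIntegral.integral_const_mul, ← circleIntegral.integral_const_mul,
        circleIntegral.integral_add ((hcont 1 (-1) hone).circleIntegrable hr0.le)
        (hc'.circleIntegrable hr0.le)]
    simp only [h1]
    rw [← circleIntegral.integral_fun_sum]
    · refine circleIntegral.integral_congr hr0.le fun w hw => ?_
      have hw1 := hsph w hw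
      have hu : (1 : ℂ) - q * w ≠ 0 := by
        intro h0
        have h2 : (q : ℂ) * w = 1 := by linear_combination -h0
        have h3 := congrArg norm h2
        rw [norm_mul, Complex.norm_real, norm_one, Real.norm_eq_abs, abs_of_nonneg hq] at h3
        nlinarith [hr.2.1, norm_nonneg w]
      have hPF := vdm_div_prod_eq_sum y hpC hu fun i => by
        have := hden i w hw1
        convert this using 1
        ring
      have hprod : ∏ j, ((p : ℂ) + q * y j * w - y j)⁻¹ = (∏ j, (p - (1 - q * w) * y j))⁻¹ := by
        rw [← Finset.prod_inv_distrib]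
        refine Finset.prod_congr rfl fun j _ => ?_
        congr 1
        ring
      rw [hprod]
      have h4 : vdm y * (∏ j, (w - y j)) * (∏ j, (p - (1 - q * w) * y j))⁻¹ * (1 - w)⁻¹ * w ^ z
          = (vdm y / ∏ j, (p - (1 - q * w) * y j)) * ((∏ j, (w - y j)) * (1 - w)⁻¹ * w ^ z) := by
        ring
      rw [h4, hPF, mul_assoc, Finset.sum_mul, Finset.mul_sum]
      refine Finset.sum_congr rfl fun i _ => ?_
      have h5 := hden i w hw1
      have h6 : (p : ℂ) - (1 - q * w) * y i = (p : ℂ) - y i + q * y i * w := by ring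
      have h7 : (1 : ℂ) + (-1) * w = 1 - w := by ring
      have h8 := one_sub_ne_zero hr.2.1 hw1
      have h9 := hy1 i
      -- Because `p + q = 1`, the second denominator equals `p (1 - y i)` at `w = 1`.
      have h10 : (1 - w)⁻¹ / (p - y i + q * y i * w)
          = (p * (1 - y i))⁻¹ * ((1 - w)⁻¹ + q * y i / (p - y i + q * y i * w)) := by
        have hq' : (q : ℂ) = 1 - p := by linear_combination hpqC
        obtain ⟨D, hD⟩ : ∃ D, D = (p : ℂ) - y i + q * y i * w := ⟨_, rfl⟩
        rw [← hD] at h5 ⊢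
        field_simp
        rw [hD, hq']
        ring
      rw [h6, h7, hC]
      linear_combination ((p : ℂ) ^ t)⁻¹ * vdmCoeff y i * y i ^ t * (∏ j, (w - y j)) * w ^ z * h10
    · intro i _
      refine ContinuousOn.circleIntegrable hr0.le ?_
      exact continuousOn_const.mul ((hcont 1 (-1) hone).add
        (continuousOn_const.mul (hcont _ _ (hden i))))
  rw [hsplit, hA 1 (-1) hone]
  simp only [hA _ _ (hden _)]
  have hpi : (2 * Real.pi * Complex.I : ℂ) ≠ 0 := Complex.two_pi_I_ne_zero
  -- Here `u = p`, the value of `1 - q w` at `w = 1`; this resums the contributions of that pole.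
  have hPF := vdm_div_prod_eq_sum y hpC hpC fun i => by
    have := mul_ne_zero hpC (hy1 i)
    convert this using 1
    ring
  have hmain : ∑ i, C i * ∏ j, (1 - y j) = ((p : ℂ) ^ (t + 1))⁻¹ * vdm y := by
    have h1 : ∏ j, ((p : ℂ) - p * y j) = p ^ (t + 1) * ∏ j, (1 - y j) := by
      have : ∀ j, (p : ℂ) - p * y j = p * (1 - y j) := fun j => by ring
      simp only [this, Finset.prod_mul_distrib]
      simp
    have h2 : ∏ j, (1 - y j) ≠ 0 := Finset.prod_ne_zero_iff.2 fun j _ => hy1 j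
    have h3 : ∑ i, C i = vdm y / ∏ j, ((p : ℂ) - p * y j) := by
      rw [hPF, Finset.mul_sum]
      refine Finset.sum_congr rfl fun i _ => ?_
      rw [hC, show (p : ℂ) - p * y i = p * (1 - y i) by ring]
      simp only
      ring
    rw [← Finset.sum_mul, h3, h1]
    field_simp
  rw [← hmain, ← Finset.sum_add_distrib, Finset.mul_sum]
  refine Finset.sum_congr rfl fun i _ => ?_
  have h7 : ∀ j, (1 : ℂ) + (-1) * y j = 1 - y j := fun j => by ring
  simp only [h7, neg_neg, one_pow, residueTerm, hC]
  have h11 : (-((q : ℂ) * y i)) ^ l = (-q) ^ l * y i ^ l := by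
    rw [← neg_mul, mul_pow]
  rw [h11, pow_add (y i) l, pow_succ (y i) t]
  field_simp

/-- The integrand, at time zero, of the tail probability of the first particle. -/
noncomputable def kern (p q : ℝ) {n : ℕ} (e : Fin n → ℤ) (ξ : Fin n → ℂ) : ℂ :=
  vdm ξ * pairDenInv p q ξ * (∏ i, (1 - ξ i))⁻¹ * ∏ i, ξ i ^ (-e i - 1)

theorem holomorphic_kern_factor {p q r : ℝ} (hr : SmallRadius p q r) (n : ℕ) :
    HolomorphicOnPolydisc r fun ξ : Fin n → ℂ =>
      vdm ξ * pairDenInv p q ξ * (∏ i, (1 - ξ i))⁻¹ :=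
  ((HolomorphicOnPolydisc.of_differentiable differentiable_vdm).mul
    (holomorphic_pairDenInv hr n)).mul (holomorphic_prod_one_sub_inv hr.2.1 n)

theorem continuousOn_kern {p q r : ℝ} (hr : SmallRadius p q r) {n : ℕ} (e : Fin n → ℤ) :
    ContinuousOn (kern p q e) (torus r n) :=
  (holomorphic_kern_factor hr n).continuousOn.mul (continuousOn_prod_zpow hr.1 _)

theorem contourIntegral_kern_of_neg {p q r : ℝ} (hr : SmallRadius p q r) {n : ℕ} {e : Fin n → ℤ}
    {i : Fin n} (hi : e i < 0) : contourIntegral r (kern p q e) = 0 := by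
  have := contourIntegral_holomorphic_mul_zpow hr.1 (holomorphic_kern_factor (p := p) (q := q) hr n)
    (fun j => -e j - 1) i 0 (by simp; omega)
  simp only [pow_zero, one_mul] at this
  exact this

theorem kern_snoc (p q : ℝ) {n : ℕ} (e : Fin (n + 1) → ℤ) (y : Fin n → ℂ) (w : ℂ) :
    kern p q e (Fin.snoc (α := fun _ => ℂ) y w)
      = pairDenInv p q y * (∏ i, (1 - y i))⁻¹ * (∏ i, y i ^ (-e i.castSucc - 1)) *
        (vdm y * (∏ j, (w - y j)) * (∏ j, ((p : ℂ) + q * y j * w - y j)⁻¹) * (1 - w)⁻¹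
          * w ^ (-e (Fin.last n) - 1)) := by
  have h : pairDenInv p q (Fin.snoc (α := fun _ => ℂ) y w)
      = pairDenInv p q y * ∏ j, ((p : ℂ) + q * y j * w - y j)⁻¹ := by
    unfold pairDenInv
    rw [prod_Ioi_castSucc]
    simp
  unfold kern
  rw [h, vdm_snoc, Fin.prod_univ_castSucc, Fin.prod_univ_castSucc]
  simp only [Fin.snoc_castSucc, Fin.snoc_last, mul_inv]
  ring

theorem le_apply_of_strictMono {n : ℕ} {e : Fin (n + 1) → ℤ} (he : StrictMono e) (h0 : 0 ≤ e 0)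
    (i : Fin (n + 1)) : ((i : ℕ) : ℤ) ≤ e i := by
  induction i using Fin.induction with
  | zero => simpa using h0
  | succ i ih =>
    have := he (Fin.castSucc_lt_succ (i := i))
    simp only [Fin.val_castSucc, Fin.val_succ] at ih ⊢
    push_cast
    omega

/-- A negative `e i` removes the pole at `ξ i = 0`. Otherwise the last integration gives `p ^ (-n)`
times the smaller kernel, and the residue terms vanish: `e i < e (Fin.last n)`, so the power of `y
i` they carry outweighs the pole at `y i = 0`. -/
theorem contourIntegral_kern {p q r : ℝ} (hp : 0 ≤ p) (hq : 0 ≤ q) (hpq : p + q = 1)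
    (hp0 : p ≠ 0) (hr : SmallRadius p q r) {n : ℕ} {e : Fin n → ℤ} (he : StrictMono e) :
    contourIntegral r (kern p q e) * ∏ i : Fin n, (p : ℂ) ^ (i : ℕ)
      = if ∀ i, 0 ≤ e i then 1 else 0 := by
  have hr0 := hr.1
  have hpC : (p : ℂ) ≠ 0 := by exact_mod_cast hp0
  induction n with
  | zero => simp [contourIntegral_dim_zero, kern, vdm, pairDenInv]
  | succ n ih =>
    by_cases hall : ∀ i, 0 ≤ e i
    swap
    · rw [if_neg hall]
      push Not at hall
      obtain ⟨i, hi⟩ := hall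
      rw [contourIntegral_kern_of_neg hr hi, zero_mul]
    rw [if_pos hall, contourIntegral_eq_inner hr0 (continuousOn_kern hr e) (Fin.last n)]
    simp only [Fin.insertNth_last', kern_snoc, circleIntegral.integral_const_mul]
    -- Strict growth from a nonnegative start makes `l = e (Fin.last n) - n` a natural number, as
    -- the residue formula requires.
    have hn : (n : ℤ) ≤ e (Fin.last n) := by
      simpa using le_apply_of_strictMono he (hall 0) (Fin.last n)
    obtain ⟨l, hl⟩ := Int.eq_ofNat_of_zero_le (sub_nonneg.2 hn)
    have hl' : e (Fin.last n) = ((l + n : ℕ) : ℤ) := by push_cast; omega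
    rw [hl']
    obtain _ | t := n
    · have h1 : ∀ w : ℂ, ‖w‖ ≤ r → (1 : ℂ) + (-1) * w ≠ 0 := fun w hw => by
        have := one_sub_ne_zero hr.2.1 hw
        convert this using 1
        ring
      have h2 := circleIntegral_zpow_div_linear hr0 h1 l
      have h3 : (∮ w in C(0, r), (1 - w)⁻¹ * w ^ (-(l : ℤ) - 1)) = 2 * Real.pi * Complex.I := by
        rw [show (2 * Real.pi * Complex.I : ℂ) = 2 * Real.pi * Complex.I *
          ((- -1 : ℂ) ^ l / 1 ^ (l + 1)) by simp, ← h2]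
        congr 1
        ext w
        rw [div_eq_inv_mul]
        ring
      rw [contourIntegral_dim_zero]
      have h4 : (2 * Real.pi * Complex.I : ℂ) ≠ 0 := Complex.two_pi_I_ne_zero
      simp [vdm, pairDenInv, h3, -mul_inv_rev, h4]
    have hstep : contourIntegral r (fun y : Fin (t + 1) → ℂ => (2 * Real.pi * Complex.I)⁻¹ *
        (pairDenInv p q y * (∏ i, (1 - y i))⁻¹ * (∏ i, y i ^ (-e i.castSucc - 1)) *
        ∮ w in C(0, r), vdm y * (∏ j, (w - y j)) * (∏ j, ((p : ℂ) + q * y j * w - y j)⁻¹)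
          * (1 - w)⁻¹ * w ^ (-((l + (t + 1) : ℕ) : ℤ) - 1)))
        = contourIntegral r fun y => ((p : ℂ) ^ (t + 1))⁻¹ * kern p q (e ∘ Fin.castSucc) y
          + ∑ i, y i ^ (l + (t + 1)) * (residueTerm p q l i y * pairDenInv p q y *
            (∏ i, (1 - y i))⁻¹) * ∏ i, y i ^ (-e i.castSucc - 1) := by
      refine contourIntegral_congr hr0 fun y hy => ?_
      rw [mul_left_comm, circleIntegral_last_variable hp hq hpq hp0 hr l hy, mul_add,
        Finset.mul_sum]
      congr 1
      · simp only [kern, Function.comp_apply]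
        ring
      · exact Finset.sum_congr rfl fun i _ => by ring
    have hG : ∀ i : Fin (t + 1), HolomorphicOnPolydisc r fun y : Fin (t + 1) → ℂ =>
        residueTerm p q l i y * pairDenInv p q y * (∏ i, (1 - y i))⁻¹ := fun i =>
      ((holomorphic_residueTerm hp0 hr l i).mul (holomorphic_pairDenInv hr _)).mul
        (holomorphic_prod_one_sub_inv hr.2.1 _)
    have hGc : ∀ i : Fin (t + 1), ContinuousOn (fun y : Fin (t + 1) → ℂ =>
        y i ^ (l + (t + 1)) * (residueTerm p q l i y * pairDenInv p q y * (∏ i, (1 - y i))⁻¹)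
          * ∏ i, y i ^ (-e i.castSucc - 1)) (torus r (t + 1)) := fun i =>
      (((continuous_apply i).pow _).continuousOn.mul (hG i).continuousOn).mul
        (continuousOn_prod_zpow hr0 _)
    have hkc : ContinuousOn (fun y => ((p : ℂ) ^ (t + 1))⁻¹ * kern p q (e ∘ Fin.castSucc) y)
        (torus r (t + 1)) := continuousOn_const.mul (continuousOn_kern hr _)
    rw [hstep, contourIntegral_add hr0 hkc
      (continuousOn_finsetSum _ fun i _ => hGc i), contourIntegral_const_mul,
      contourIntegral_sum hr0 _ hGc, Finset.sum_eq_zero, add_zero, Fin.prod_univ_castSucc]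
    · have h1 := ih (e := e ∘ Fin.castSucc) (he.comp Fin.strictMono_castSucc)
      rw [if_pos (show ∀ i, 0 ≤ (e ∘ Fin.castSucc) i from fun i => hall _)] at h1
      simp only [Fin.val_castSucc, Fin.val_last]
      have hpt : (p : ℂ) ^ (t + 1) ≠ 0 := pow_ne_zero _ hpC
      field_simp
      linear_combination h1
    · intro i _
      refine contourIntegral_holomorphic_mul_zpow hr0 (hG i) _ i (l + (t + 1)) ?_
      have := he (Fin.castSucc_lt_last i)
      omega

/-! ### Bethe waves and their values at time zero -/

/-- The factor of the integrand that is symmetric and does not depend on time. -/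
noncomputable def symmFactor {n : ℕ} (ξ : Fin n → ℂ) : ℂ :=
  (1 - ∏ i, ξ i) / ∏ i, (1 - ξ i)

/-- The Bethe wave with the multiplier `M`. -/
noncomputable def wave (p q : ℝ) (x : ℤ) {n : ℕ} (M : (Fin n → ℂ) → ℂ) (Y : Fin n → ℤ)
    (ξ : Fin n → ℂ) : ℂ :=
  vdm ξ * pairDenInv p q ξ * M ξ * ∏ i, ξ i ^ (x - Y i - 1)

theorem continuousOn_wave {p q r : ℝ} (hr : SmallRadius p q r) (x : ℤ) {n : ℕ}
    {M : (Fin n → ℂ) → ℂ} (hM : ContinuousOn M (torus r n)) (Y : Fin n → ℤ) :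
    ContinuousOn (wave p q x M Y) (torus r n) :=
  ((differentiable_vdm.continuous.continuousOn.mul
    (holomorphic_pairDenInv hr n).continuousOn).mul hM).mul (continuousOn_prod_zpow hr.1 _)

theorem integrand_eq_wave_mul_exp (p q t : ℝ) (x : ℤ) {n : ℕ} (Y : Fin n → ℤ) (ξ : Fin n → ℂ) :
    integrand p q t x Y ξ
      = wave p q x symmFactor Y ξ * Complex.exp ((∑ i, eps p q (ξ i)) * t) := by
  unfold integrand wave symmFactor vdm pairDenInv
  simp only [div_eq_mul_inv, Finset.prod_mul_distrib, Finset.sum_mul, Complex.exp_sum]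
  ring

/-- Multiplication by `∏ ξ i` shifts `x` by one, so the numerator `1 - ∏ ξ i` produces the
difference of the indicators of `x ≤ Y 0` and `x + 1 ≤ Y 0`. -/
theorem contourIntegral_wave_symmFactor {p q r : ℝ} (hp : 0 ≤ p) (hq : 0 ≤ q) (hpq : p + q = 1)
    (hp0 : p ≠ 0) (hr : SmallRadius p q r) {n : ℕ} {Y : Fin (n + 1) → ℤ} (hY : StrictMono Y)
    (x : ℤ) :
    contourIntegral r (wave p q x symmFactor Y) * ∏ i : Fin (n + 1), (p : ℂ) ^ (i : ℕ)
      = if Y 0 = x then 1 else 0 := by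
  have hr0 := hr.1
  have h : contourIntegral r (wave p q x symmFactor Y)
      = contourIntegral r (kern p q fun i => Y i - x)
        - contourIntegral r (kern p q fun i => Y i - (x + 1)) := by
    rw [← contourIntegral_sub hr0 (continuousOn_kern hr _) (continuousOn_kern hr _)]
    refine contourIntegral_congr hr0 fun ξ hξ => ?_
    have h1 : ∏ i, ξ i ^ (-(Y i - (x + 1)) - 1) = (∏ i, ξ i) * ∏ i, ξ i ^ (x - Y i - 1) := by
      rw [← Finset.prod_mul_distrib]
      refine Finset.prod_congr rfl fun i _ => ?_
      rw [← zpow_one_add₀ (ne_zero_of_mem_torus hr0 hξ i)]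
      congr 1
      ring
    have h2 : ∏ i, ξ i ^ (-(Y i - x) - 1) = ∏ i, ξ i ^ (x - Y i - 1) :=
      Finset.prod_congr rfl fun i _ => by congr 1; ring
    simp only [wave, symmFactor, kern, h1, h2]
    ring
  rw [h, sub_mul, contourIntegral_kern hp hq hpq hp0 hr (fun a b hab => by have := hY hab; omega),
    contourIntegral_kern hp hq hpq hp0 hr (fun a b hab => by have := hY hab; omega)]
  have hmin : ∀ c : ℤ, (∀ i, 0 ≤ Y i - c) ↔ c ≤ Y 0 := fun c =>
    ⟨fun h => by have := h 0; omega, fun h i => by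
      have := hY.monotone (Fin.zero_le i); omega⟩
  simp only [hmin]
  split_ifs <;> first | omega | simp

theorem prod_zpow_update {n : ℕ} {ξ : Fin n → ℂ} (h0 : ∀ i, ξ i ≠ 0) (x : ℤ) (Y : Fin n → ℤ)
    (i : Fin n) (c : ℤ) :
    ∏ j, ξ j ^ (x - Function.update Y i c j - 1)
      = ξ i ^ (Y i - c) * ∏ j, ξ j ^ (x - Y j - 1) := by
  rw [← Finset.mul_prod_erase Finset.univ _ (Finset.mem_univ i),
    ← Finset.mul_prod_erase Finset.univ (fun j => ξ j ^ (x - Y j - 1)) (Finset.mem_univ i),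
    Function.update_self, ← mul_assoc, ← zpow_add₀ (h0 i)]
  congr 1
  · congr 1
    ring
  · exact Finset.prod_congr rfl fun j hj => by
      rw [Function.update_of_ne (Finset.ne_of_mem_erase hj)]

/-! ### Free generator and boundary condition for Bethe waves -/

/-- A function on `ℤⁿ` satisfies the exclusion boundary condition. -/
def BoundaryCondition (p q : ℝ) {n : ℕ} (Φ : (Fin n → ℤ) → ℂ) : Prop :=
  ∀ (Y : Fin n → ℤ) (a b : Fin n), (b : ℕ) = a + 1 → Y b = Y a + 1 →
    p * Φ (Function.update Y a (Y b)) + q * Φ (Function.update Y b (Y a)) = Φ Y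

/-- The generator of `n` independent walks. -/
def freeGenerator (p q : ℝ) {n : ℕ} (Φ : (Fin n → ℤ) → ℂ) (Y : Fin n → ℤ) : ℂ :=
  ∑ i, (p * (Φ (Function.update Y i (Y i + 1)) - Φ Y)
    + q * (Φ (Function.update Y i (Y i - 1)) - Φ Y))

/-- Moving `Y i` by `±1` multiplies the wave by `ξ i ^ (∓1)`, and `p ξ⁻¹ + q ξ - 1 = ε(ξ)`. -/
theorem freeGenerator_contourIntegral_wave {p q r : ℝ} (hpq : p + q = 1)
    (hr : SmallRadius p q r) (x : ℤ) {n : ℕ} {M : (Fin n → ℂ) → ℂ}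
    (hM : ContinuousOn M (torus r n)) (Y : Fin n → ℤ) :
    freeGenerator p q (fun Y => contourIntegral r (wave p q x M Y)) Y
      = contourIntegral r (wave p q x (fun ξ => M ξ * ∑ i, eps p q (ξ i)) Y) := by
  have hr0 := hr.1
  have hpqC : (p : ℂ) + q = 1 := by exact_mod_cast hpq
  have hc := fun Z => continuousOn_wave hr x hM Z
  have hc' : ∀ (c : ℂ) (Z Z' : Fin n → ℤ), ContinuousOn
      (fun ξ => c * (wave p q x M Z ξ - wave p q x M Z' ξ)) (torus r n) :=
    fun c Z Z' => continuousOn_const.mul ((hc Z).sub (hc Z'))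
  have hc2 : ∀ i, ContinuousOn
      (fun ξ => p * (wave p q x M (Function.update Y i (Y i + 1)) ξ - wave p q x M Y ξ)
        + q * (wave p q x M (Function.update Y i (Y i - 1)) ξ - wave p q x M Y ξ)) (torus r n) :=
    fun i => (hc' _ _ _).add (hc' _ _ _)
  unfold freeGenerator
  simp only [← contourIntegral_sub hr0 (hc _) (hc _), ← contourIntegral_const_mul]
  simp only [← contourIntegral_add hr0 (hc' _ _ _) (hc' _ _ _)]
  rw [← contourIntegral_sum hr0 _ hc2]
  refine contourIntegral_congr hr0 fun ξ hξ => ?_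
  have h0 := ne_zero_of_mem_torus hr0 hξ
  simp only [wave, prod_zpow_update h0, Finset.mul_sum, Finset.sum_mul]
  refine Finset.sum_congr rfl fun i _ => ?_
  have h1 : Y i - (Y i + 1) = -1 := by ring
  have h2 : Y i - (Y i - 1) = 1 := by ring
  rw [h1, h2, zpow_neg_one, zpow_one, eps]
  linear_combination (vdm ξ * pairDenInv p q ξ * M ξ * ∏ j, ξ j ^ (x - Y j - 1)) * (-hpqC)

theorem vdm_comp_swap {R : Type*} [CommRing R] {n : ℕ} (v : Fin n → R) {a b : Fin n}
    (hab : a ≠ b) : vdm (v ∘ Equiv.swap a b) = -vdm v := by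
  have h : ∀ w : Fin n → R, vdm w = (Matrix.vandermonde w).det := fun w =>
    (Matrix.det_vandermonde w).symm
  rw [h, h]
  have := Matrix.det_permute (Equiv.swap a b) (Matrix.vandermonde v)
  rw [Equiv.Perm.sign_swap hab] at this
  simp only [Units.val_neg, Units.val_one, Int.cast_neg, Int.cast_one, neg_one_mul] at this
  exact this

/-- An adjacent transposition permutes the pairs `i < j` other than `(a, b)` and reverses that one.
-/
theorem prod_Ioi_comp_swap {M : Type*} [CommMonoid M] {n : ℕ} (F : Fin n → Fin n → M)
    {a b : Fin n} (hab : (b : ℕ) = a + 1) :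
    (∏ i, ∏ j ∈ Finset.Ioi i, F (Equiv.swap a b i) (Equiv.swap a b j)) * F a b
      = (∏ i, ∏ j ∈ Finset.Ioi i, F i j) * F b a := by
  have key : ∀ G : Fin n → Fin n → M, ∏ i, ∏ j ∈ Finset.Ioi i, G i j
      = G a b * ∏ x ∈ (Finset.univ.filter fun x : Fin n × Fin n => x.1 < x.2).erase (a, b),
        G x.1 x.2 := by
    intro G
    have hm : (a, b) ∈ Finset.univ.filter fun x : Fin n × Fin n => x.1 < x.2 :=
      Finset.mem_filter.2 ⟨Finset.mem_univ _, Fin.lt_def.2 (by simp [hab])⟩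
    rw [Finset.mul_prod_erase _ (fun x : Fin n × Fin n => G x.1 x.2) hm,
      Finset.prod_filter, Fintype.prod_prod_type]
    simp only [← Finset.filter_lt_eq_Ioi, Finset.prod_filter]
  have hlt : ∀ i j : Fin n, i < j → (i, j) ≠ (a, b) →
      Equiv.swap a b i < Equiv.swap a b j ∧ (Equiv.swap a b i, Equiv.swap a b j) ≠ (a, b) := by
    intro i j hij hne
    simp only [ne_eq, Prod.mk.injEq, Fin.lt_def, Fin.ext_iff] at *
    simp only [Equiv.swap_apply_def, Fin.ext_iff]
    split_ifs <;> omega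
  rw [key, key F, Equiv.swap_apply_left, Equiv.swap_apply_right]
  have hrest : ∏ x ∈ (Finset.univ.filter fun x : Fin n × Fin n => x.1 < x.2).erase (a, b),
      F (Equiv.swap a b x.1) (Equiv.swap a b x.2)
      = ∏ x ∈ (Finset.univ.filter fun x : Fin n × Fin n => x.1 < x.2).erase (a, b),
      F x.1 x.2 := by
    have hmem : ∀ x ∈ (Finset.univ.filter fun x : Fin n × Fin n => x.1 < x.2).erase (a, b),
        (Equiv.swap a b x.1, Equiv.swap a b x.2) ∈
          (Finset.univ.filter fun x : Fin n × Fin n => x.1 < x.2).erase (a, b) := by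
      rintro ⟨i, j⟩ hx
      simp only [Finset.mem_erase, Finset.mem_filter, Finset.mem_univ, true_and] at hx ⊢
      exact (hlt i j hx.2 hx.1).symm
    refine Finset.prod_nbij' (fun x => (Equiv.swap a b x.1, Equiv.swap a b x.2))
      (fun x => (Equiv.swap a b x.1, Equiv.swap a b x.2)) hmem hmem ?_ ?_ ?_ <;> simp
  rw [hrest]
  simp only [mul_comm, mul_left_comm]

/-- The defect carries the factor `p / ξ a + q ξ b - 1`, whose numerator cancels the `(a, b)`
denominator. What remains is the Vandermonde product times a function symmetric in `ξ a` and `ξ b`,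
so its integral vanishes. -/
theorem boundaryCondition_contourIntegral_wave {p q r : ℝ}
    (hr : SmallRadius p q r) (x : ℤ) {n : ℕ} {M : (Fin n → ℂ) → ℂ}
    (hM : ContinuousOn M (torus r n)) (hs : ∀ (σ : Equiv.Perm (Fin n)) ξ, M (ξ ∘ σ) = M ξ) :
    BoundaryCondition p q fun Y => contourIntegral r (wave p q x M Y) := by
  intro Y a b hab hY
  have hr0 := hr.1
  have hne : a ≠ b := by rintro rfl; omega
  have hc := fun Z => continuousOn_wave hr x hM Z
  have hc1 : ∀ (c : ℂ) (Z : Fin n → ℤ), ContinuousOn (fun ξ => c * wave p q x M Z ξ) (torus r n) :=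
    fun c Z => continuousOn_const.mul (hc Z)
  have hc2 : ContinuousOn (fun ξ => p * wave p q x M (Function.update Y a (Y b)) ξ
      + q * wave p q x M (Function.update Y b (Y a)) ξ) (torus r n) := (hc1 _ _).add (hc1 _ _)
  rw [← sub_eq_zero]
  simp only [← contourIntegral_const_mul]
  rw [← contourIntegral_add hr0 (hc1 _ _) (hc1 _ _),
    ← contourIntegral_sub hr0 hc2 (hc _)]
  -- `Z` has equal entries at `a` and `b`, which makes its monomial invariant under the swap.
  set Z := Function.update Y a (Y b) with hZ
  have hZs : ∀ j, Z (Equiv.swap a b j) = Z j := by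
    intro j
    rw [Equiv.swap_apply_def]
    split_ifs with h1 h2
    · rw [h1, hZ, Function.update_self, Function.update_of_ne hne.symm]
    · rw [h2, hZ, Function.update_self, Function.update_of_ne hne.symm]
    · rfl
  have hform : ∀ ξ ∈ torus r n, p * wave p q x M Z ξ + q * wave p q x M (Function.update Y b (Y a)) ξ
      - wave p q x M Y ξ
      = vdm ξ * (pairDenInv p q ξ * (p + q * ξ a * ξ b - ξ a)) * M ξ *
        ∏ j, ξ j ^ (x - Z j - 1) := by
    intro ξ hξ
    have h0 := ne_zero_of_mem_torus hr0 hξ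
    have e1 : Y a - Y b = -1 := by omega
    have e2 : Y b - Y a = 1 := by omega
    simp only [wave, hZ, prod_zpow_update h0, e1, e2, zpow_neg_one, zpow_one]
    have := h0 a
    field_simp
  refine contourIntegral_eq_zero_of_antisymm hr0 (Equiv.swap a b) fun ξ hξ => ?_
  have hξ' : ξ ∘ Equiv.swap a b ∈ torus r n := fun i => hξ _
  rw [hform _ hξ', hform _ hξ, hs, vdm_comp_swap _ hne]
  have hprod : ∏ j, (ξ ∘ Equiv.swap a b) j ^ (x - Z j - 1) = ∏ j, ξ j ^ (x - Z j - 1) := by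
    rw [← Equiv.prod_comp (Equiv.swap a b) fun j => ξ j ^ (x - Z j - 1)]
    exact Finset.prod_congr rfl fun j _ => by rw [Function.comp_apply, hZs]
  have hD : pairDenInv p q (ξ ∘ Equiv.swap a b) * (p + q * ξ b * ξ a - ξ b)
      = pairDenInv p q ξ * (p + q * ξ a * ξ b - ξ a) := by
    have h1 := prod_Ioi_comp_swap (fun i j => ((p : ℂ) + q * ξ i * ξ j - ξ i)⁻¹) hab
    have h2 := hr.2.2 (ξ a) (ξ b) (hξ a).le (hξ b).le
    have h3 := hr.2.2 (ξ b) (ξ a) (hξ b).le (hξ a).le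
    change pairDenInv p q (ξ ∘ Equiv.swap a b) * _ = pairDenInv p q ξ * _ at h1
    rwa [← div_eq_mul_inv, ← div_eq_mul_inv, div_eq_div_iff h2 h3] at h1
  rw [hprod]
  simp only [Function.comp_apply, Equiv.swap_apply_left, Equiv.swap_apply_right, hD]
  ring

theorem symm_sum_eps (p q : ℝ) {n : ℕ} (σ : Equiv.Perm (Fin n)) (ξ : Fin n → ℂ) :
    ∑ i, eps p q ((ξ ∘ σ) i) = ∑ i, eps p q (ξ i) :=
  Equiv.sum_comp σ fun i => eps p q (ξ i)

theorem symm_symmFactor {n : ℕ} (σ : Equiv.Perm (Fin n)) (ξ : Fin n → ℂ) :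
    symmFactor (ξ ∘ σ) = symmFactor ξ := by
  unfold symmFactor
  rw [← Equiv.prod_comp σ fun i => ξ i, ← Equiv.prod_comp σ fun i => 1 - ξ i]
  rfl

theorem continuousOn_sum_eps {r : ℝ} (hr : 0 < r) (p q : ℝ) (n : ℕ) :
    ContinuousOn (fun ξ : Fin n → ℂ => ∑ i, eps p q (ξ i)) (torus r n) := by
  unfold eps
  refine continuousOn_finsetSum _ fun i _ => ?_
  refine ContinuousOn.sub (ContinuousOn.add (continuousOn_const.mul ?_) (by fun_prop))
    continuousOn_const
  exact (continuous_apply i).continuousOn.inv₀ fun ξ hξ => ne_zero_of_mem_torus hr hξ i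

theorem continuousOn_symmFactor {r : ℝ} (hr : r < 1) (n : ℕ) :
    ContinuousOn (symmFactor : (Fin n → ℂ) → ℂ) (torus r n) := by
  unfold symmFactor
  refine ContinuousOn.div (by fun_prop) (by fun_prop) fun ξ hξ =>
    Finset.prod_ne_zero_iff.2 fun i _ => one_sub_ne_zero hr (hξ i).le

/-! ### Exclusion generator versus free generator -/

theorem vacant_last {n : ℕ} (X : Config (n + 1)) : Vacant X (X.1 (Fin.last n) + 1) := fun j h => by
  have := X.2.monotone (Fin.le_last j)
  omega

theorem vacant_zero {n : ℕ} (X : Config (n + 1)) : Vacant X (X.1 0 + -1) := fun j h => by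
  have := X.2.monotone (Fin.zero_le j)
  omega

theorem vacant_castSucc_iff {n : ℕ} (X : Config (n + 1)) (i : Fin n) :
    Vacant X (X.1 i.castSucc + 1) ↔ X.1 i.succ ≠ X.1 i.castSucc + 1 := by
  refine ⟨fun h => h _, fun h j hj => h ?_⟩
  have h1 : i.castSucc < j := X.2.lt_iff_lt.1 (by omega)
  have h2 := X.2.monotone (Fin.castSucc_lt_iff_succ_le.1 h1)
  have h3 := X.2 (Fin.castSucc_lt_succ (i := i))
  omega

theorem vacant_succ_iff {n : ℕ} (X : Config (n + 1)) (i : Fin n) :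
    Vacant X (X.1 i.succ + -1) ↔ X.1 i.succ ≠ X.1 i.castSucc + 1 := by
  refine ⟨fun h h' => h i.castSucc (by omega), fun h j hj => h ?_⟩
  have h1 : j < i.succ := X.2.lt_iff_lt.1 (by omega)
  have h2 := X.2.monotone (Fin.le_castSucc_iff.2 h1)
  have h3 := X.2 (Fin.castSucc_lt_succ (i := i))
  omega

/-- On configurations, the exclusion generator agrees with the free one for functions that satisfy
the boundary condition. -/
theorem sum_jump_eq_freeGenerator {p q : ℝ} (hpq : p + q = 1) {n : ℕ} {Φ : (Fin n → ℤ) → ℂ}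
    (hΦ : BoundaryCondition p q Φ) (X : Config n) :
    ∑ i, ((p : ℂ) * (Φ (jump X i 1 (Or.inl rfl)).1 - Φ X.1)
      + q * (Φ (jump X i (-1) (Or.inr rfl)).1 - Φ X.1)) = freeGenerator p q Φ X.1 := by
  have hpqC : (p : ℂ) + q = 1 := by exact_mod_cast hpq
  obtain _ | n := n
  · simp [freeGenerator]
  have hv : ∀ i d hd, Vacant X (X.1 i + d) →
      (jump X i d hd).1 = Function.update X.1 i (X.1 i + d) := fun i d hd h => by
    simp [jump, h]
  have hnv : ∀ i d hd, ¬ Vacant X (X.1 i + d) → (jump X i d hd).1 = X.1 := fun i d hd h => by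
    simp [jump, h]
  -- `R` and `L` measure the excess of free over exclusion jumps to the right and left; only blocked
  -- jumps contribute.
  set R : Fin (n + 1) → ℂ := fun i => p * (Φ (Function.update X.1 i (X.1 i + 1)) - Φ X.1)
    - p * (Φ (jump X i 1 (Or.inl rfl)).1 - Φ X.1) with hR
  set L : Fin (n + 1) → ℂ := fun i => q * (Φ (Function.update X.1 i (X.1 i - 1)) - Φ X.1)
    - q * (Φ (jump X i (-1) (Or.inr rfl)).1 - Φ X.1) with hL
  have hsum : ∑ i, R i + ∑ i, L i = 0 := by
    rw [Fin.sum_univ_castSucc, Fin.sum_univ_succ L]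
    have hRl : R (Fin.last n) = 0 := by
      simp only [hR, hv _ _ _ (vacant_last X)]
      ring
    have hL0 : L 0 = 0 := by
      simp only [hL, hv _ _ _ (vacant_zero X), sub_eq_add_neg]
      ring
    rw [hRl, hL0, add_zero, zero_add, ← Finset.sum_add_distrib]
    -- The right jump of a particle is blocked exactly when the left jump of its right neighbour is;
    -- the boundary condition cancels the two excesses.
    refine Finset.sum_eq_zero fun i _ => ?_
    by_cases h : X.1 i.succ = X.1 i.castSucc + 1
    · have h1 := hnv i.castSucc 1 (Or.inl rfl) fun h' => (vacant_castSucc_iff X i).1 h' h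
      have h2 := hnv i.succ (-1) (Or.inr rfl) fun h' => (vacant_succ_iff X i).1 h' h
      have h3 := hΦ X.1 i.castSucc i.succ (by simp) h
      have h4 : X.1 i.succ - 1 = X.1 i.castSucc := by omega
      simp only [hR, hL, h1, h2, h4, ← h]
      linear_combination h3 - Φ X.1 * hpqC
    · simp only [hR, hL, hv _ _ _ ((vacant_castSucc_iff X i).2 h),
        hv _ _ _ ((vacant_succ_iff X i).2 h), sub_eq_add_neg]
      ring
  unfold freeGenerator
  rw [← sub_eq_zero, ← neg_eq_zero, ← hsum, ← Finset.sum_sub_distrib, ← Finset.sum_add_distrib,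
    ← Finset.sum_neg_distrib]
  refine Finset.sum_congr rfl fun i _ => ?_
  simp only [hR, hL]
  ring

/-! ### Removal of one particle -/

theorem update_self_comp_succAbove {n : ℕ} (Y : Fin (n + 1) → ℤ) (k : Fin (n + 1)) (c : ℤ) :
    Function.update Y k c ∘ k.succAbove = Y ∘ k.succAbove := by
  ext i
  simp [Fin.succAbove_ne]

theorem update_succAbove_comp_succAbove {n : ℕ} (Y : Fin (n + 1) → ℤ) (k : Fin (n + 1))
    (i : Fin n) (c : ℤ) :
    Function.update Y (k.succAbove i) c ∘ k.succAbove = Function.update (Y ∘ k.succAbove) i c :=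
  Function.update_comp_eq_of_injective _ Fin.succAbove_right_injective _ _

/-- The weighted sum over all ways to remove one particle. -/
def removalSum (τ : ℂ) {n : ℕ} (v : (Fin n → ℤ) → ℂ) (Y : Fin (n + 1) → ℤ) : ℂ :=
  ∑ k : Fin (n + 1), τ ^ (k : ℕ) * v (Y ∘ k.succAbove)

/-- Moving particle `k` does not affect the configuration without it, so that contribution drops
out. -/
theorem freeGenerator_removalSum (p q : ℝ) (τ : ℂ) {n : ℕ} (v : (Fin n → ℤ) → ℂ)
    (Y : Fin (n + 1) → ℤ) :
    freeGenerator p q (removalSum τ v) Y = removalSum τ (freeGenerator p q v) Y := by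
  unfold freeGenerator removalSum
  simp only [← Finset.sum_sub_distrib, Finset.mul_sum, ← Finset.sum_add_distrib]
  rw [Finset.sum_comm]
  refine Finset.sum_congr rfl fun k _ => ?_
  rw [Fin.sum_univ_succAbove _ k]
  simp only [update_self_comp_succAbove, update_succAbove_comp_succAbove, Function.comp_apply,
    sub_self, mul_zero, zero_add]
  exact Finset.sum_congr rfl fun i _ => by ring

theorem succAbove_eq_of_adjacent {n : ℕ} {a b : Fin (n + 1)} (hab : (b : ℕ) = a + 1) (i : Fin n) :
    (a.succAbove i = b ∧ b.succAbove i = a) ∨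
      (a.succAbove i = b.succAbove i ∧ a.succAbove i ≠ a ∧ b.succAbove i ≠ b) := by
  by_cases hi : (i : ℕ) = a
  · left
    simp only [Fin.ext_iff, Fin.succAbove, Fin.lt_def]
    constructor <;> split_ifs <;> simp_all
  · refine Or.inr ⟨?_, Fin.succAbove_ne a i, Fin.succAbove_ne b i⟩
    simp only [Fin.ext_iff, Fin.succAbove, Fin.lt_def]
    split_ifs <;> simp_all <;> omega

/-- Moving one member of the pair onto the other exchanges the effects of removing `a` and `b`;
these two terms balance because `τ p = q` and `p + q = 1`. Any other removal leaves the pair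
adjacent, and the condition for `v` applies. -/
theorem BoundaryCondition.removalSum {p q : ℝ} (hpq : p + q = 1) {τ : ℂ} (hτ : τ * p = q) {n : ℕ}
    {v : (Fin n → ℤ) → ℂ} (hv : BoundaryCondition p q v) :
    BoundaryCondition p q (ASEP.removalSum τ v) := by
  intro Y a b hab hY
  have hpqC : (p : ℂ) + q = 1 := by exact_mod_cast hpq
  have hne : a ≠ b := by rintro rfl; omega
  rw [← sub_eq_zero]
  unfold ASEP.removalSum
  rw [Finset.mul_sum, Finset.mul_sum, ← Finset.sum_add_distrib, ← Finset.sum_sub_distrib,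
    Fintype.sum_eq_add a b hne]
  · have h1 : Function.update Y b (Y a) ∘ a.succAbove = Y ∘ b.succAbove := by
      ext i
      rcases succAbove_eq_of_adjacent hab i with ⟨e1, e2⟩ | ⟨e1, e2, e3⟩
      · simp [e1, e2]
      · simp [e1, e3]
    have h2 : Function.update Y a (Y b) ∘ b.succAbove = Y ∘ a.succAbove := by
      ext i
      rcases succAbove_eq_of_adjacent hab i with ⟨e1, e2⟩ | ⟨e1, e2, e3⟩
      · simp [e1, e2]
      · simp [← e1, e2]
    rw [update_self_comp_succAbove, update_self_comp_succAbove, h1, h2, hab, pow_succ]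
    linear_combination (τ ^ (a : ℕ) * (v (Y ∘ a.succAbove) - v (Y ∘ b.succAbove))) * (hτ)
      + τ ^ (a : ℕ) * (v (Y ∘ a.succAbove) + τ * v (Y ∘ b.succAbove)) * hpqC
  · rintro k ⟨hka, hkb⟩
    obtain ⟨a', ha'⟩ := Fin.exists_succAbove_eq (Ne.symm hka)
    obtain ⟨b', hb'⟩ := Fin.exists_succAbove_eq (Ne.symm hkb)
    have hab' : (b' : ℕ) = a' + 1 := by
      have h1 := congrArg Fin.val ha'
      have h2 := congrArg Fin.val hb'
      have h3 : (k : ℕ) ≠ a := fun h => hka (Fin.ext h)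
      have h4 : (k : ℕ) ≠ b := fun h => hkb (Fin.ext h)
      simp only [Fin.succAbove, Fin.lt_def] at h1 h2
      split_ifs at h1 h2 <;> simp_all <;> omega
    have h := hv (Y ∘ k.succAbove) a' b' hab' (by simp [ha', hb', hY])
    rw [← ha', ← hb', update_succAbove_comp_succAbove, update_succAbove_comp_succAbove]
    simp only [Function.comp_apply] at h
    linear_combination τ ^ (k : ℕ) * h

/-! ### Coefficients of the power series in time -/

theorem remove_eq_comp_succAbove {n : ℕ} (Y : Fin (n + 1) → ℤ) (k : Fin (n + 1)) :
    remove Y k = Y ∘ k.succAbove := by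
  ext i
  simp only [remove, Function.comp_apply]
  split_ifs with h
  · rw [Fin.succAbove_of_castSucc_lt _ _ (by simpa [Fin.lt_def] using h)]
    rfl
  · rw [Fin.succAbove_of_le_castSucc _ _ (by simpa [Fin.le_def] using h)]
    rfl

theorem prod_pow_val (a : ℂ) (n : ℕ) : ∏ i : Fin n, a ^ (i : ℕ) = a ^ (n * (n - 1) / 2) := by
  rw [Finset.prod_pow_eq_pow_sum, Fin.sum_univ_eq_sum_range (fun i => i), Finset.sum_range_id]

theorem mul_bracket_eq_sum {p : ℝ} (hp0 : p ≠ 0) (q : ℝ) (n : ℕ) :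
    (q : ℂ) * bracket p q n = p ^ n * ∑ k : Fin n, ((q : ℂ) / p) ^ ((k : ℕ) + 1) := by
  have hpC : (p : ℂ) ≠ 0 := by exact_mod_cast hp0
  rw [Fin.sum_univ_eq_sum_range (fun k => ((q : ℂ) / p) ^ (k + 1)), bracket,
    ← Finset.sum_range_reflect]
  push_cast
  rw [Finset.mul_sum, Finset.mul_sum]
  refine Finset.sum_congr rfl fun k hk => ?_
  have hk' := Finset.mem_range.1 hk
  have h1 : n - 1 - (n - 1 - k) = k := by omega
  have h2 : (p : ℂ) ^ n = p ^ (n - 1 - k) * p ^ (k + 1) := by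
    rw [← pow_add]
    congr 1
    omega
  rw [h1, h2, div_pow]
  field_simp
  ring

/-- The coefficients of the expansion in powers of `t` of the right hand side. -/
noncomputable def momentSum (p q r : ℝ) (x : ℤ) {n : ℕ} (k : ℕ) (Y : Fin (n + 2) → ℤ) : ℂ :=
  -(q : ℂ) * bracket p q (n + 1) * (p : ℂ) ^ ((n + 1) * n / 2) *
      contourIntegral r (wave p q x (fun ξ => symmFactor ξ * (∑ i, eps p q (ξ i)) ^ k) Y)
    + (p : ℂ) ^ ((n + 1) * n / 2) * removalSum ((q : ℂ) / p) (fun Z => contourIntegral r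
      (wave p q x (fun ξ => symmFactor ξ * (∑ i, eps p q (ξ i)) ^ k) Z)) Y

theorem momentSum_zero {p q r : ℝ} (hp : 0 ≤ p) (hq : 0 ≤ q) (hpq : p + q = 1)
    (hp0 : p ≠ 0) (hr : SmallRadius p q r) (x : ℤ) {n : ℕ} (Y : Config (n + 2)) :
    momentSum p q r x 0 Y.1 = if Y.1 1 = x then 1 else 0 := by
  have hpC : (p : ℂ) ≠ 0 := by exact_mod_cast hp0
  have h1 := contourIntegral_wave_symmFactor hp hq hpq hp0 hr Y.2 x
  have h2 := fun k : Fin (n + 2) => contourIntegral_wave_symmFactor hp hq hpq hp0 hr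
    (Y.2.comp (Fin.strictMono_succAbove k)) x
  rw [Fin.prod_univ_castSucc] at h1
  simp only [Fin.val_castSucc, Fin.val_last] at h1
  simp only [prod_pow_val, Nat.add_sub_cancel] at h1 h2
  simp only [momentSum, pow_zero, mul_one, removalSum]
  set P : ℂ := (p : ℂ) ^ ((n + 1) * n / 2)
  have h3 : P * ∑ k : Fin (n + 2), ((q : ℂ) / p) ^ (k : ℕ) *
      contourIntegral r (wave p q x symmFactor (Y.1 ∘ k.succAbove))
      = ∑ k : Fin (n + 2), ((q : ℂ) / p) ^ (k : ℕ) *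
        if (Y.1 ∘ k.succAbove) 0 = x then 1 else 0 := by
    rw [Finset.mul_sum]
    refine Finset.sum_congr rfl fun k _ => ?_
    rw [← h2 k]
    ring
  -- Removing any particle but the first keeps `Y 0` leftmost.
  have h4 : ∀ k : Fin (n + 1), (k.succ.succAbove 0 : Fin (n + 2)) = 0 := fun k =>
    Fin.succ_succAbove_zero k
  have e : (fun ξ : Fin (n + 2) → ℂ => symmFactor ξ) = symmFactor := rfl
  have e' : (fun ξ : Fin (n + 1) → ℂ => symmFactor ξ) = symmFactor := rfl
  rw [e, e', h3, Fin.sum_univ_succ]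
  simp only [Function.comp_apply, h4, ← Finset.sum_mul, Fin.val_succ, Fin.val_zero, pow_zero,
    one_mul]
  -- The total weight of the removals that leave `Y 0` in place; the `(n + 2)`-fold integral cancels
  -- them.
  have h5 := mul_bracket_eq_sum hp0 q (n + 1)
  have h6 : ((0 : Fin (n + 2)).succAbove 0 : Fin (n + 2)) = 1 := by simp
  simp only [h6]
  linear_combination (-(P * contourIntegral r (wave p q x symmFactor Y.1))) * h5
    - (∑ k : Fin (n + 1), ((q : ℂ) / p) ^ ((k : ℕ) + 1)) * h1

theorem boundaryCondition_momentSum {p q r : ℝ} (hpq : p + q = 1) (hp0 : p ≠ 0)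
    (hr : SmallRadius p q r) (x : ℤ) {n : ℕ} (k : ℕ) :
    BoundaryCondition p q (momentSum p q r x (n := n) k) := by
  have hpC : (p : ℂ) ≠ 0 := by exact_mod_cast hp0
  have hM : ∀ m : ℕ, BoundaryCondition p q fun Y : Fin m → ℤ => contourIntegral r
      (wave p q x (fun ξ => symmFactor ξ * (∑ i, eps p q (ξ i)) ^ k) Y) := fun m =>
    boundaryCondition_contourIntegral_wave hr x
      ((continuousOn_symmFactor hr.2.1 m).mul ((continuousOn_sum_eps hr.1 p q m).pow k))
      fun σ ξ => by rw [symm_symmFactor, symm_sum_eps]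
  intro Y a b hab hY
  have h1 := hM (n + 2) Y a b hab hY
  have h2 := (hM (n + 1)).removalSum hpq (div_mul_cancel₀ (q : ℂ) hpC) Y a b hab hY
  unfold momentSum
  linear_combination (-(q : ℂ) * bracket p q (n + 1) * (p : ℂ) ^ ((n + 1) * n / 2)) * h1
    + (p : ℂ) ^ ((n + 1) * n / 2) * h2

theorem freeGenerator_linear_combination (p q : ℝ) {n : ℕ} (c d : ℂ) (Φ Ψ : (Fin n → ℤ) → ℂ)
    (Y : Fin n → ℤ) :
    freeGenerator p q (fun Z => c * Φ Z + d * Ψ Z) Y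
      = c * freeGenerator p q Φ Y + d * freeGenerator p q Ψ Y := by
  unfold freeGenerator
  rw [Finset.mul_sum, Finset.mul_sum, ← Finset.sum_add_distrib]
  exact Finset.sum_congr rfl fun i _ => by ring

theorem freeGenerator_momentSum {p q r : ℝ} (hpq : p + q = 1)
    (hr : SmallRadius p q r) (x : ℤ) {n : ℕ} (k : ℕ) (Y : Fin (n + 2) → ℤ) :
    freeGenerator p q (momentSum p q r x k) Y = momentSum p q r x (k + 1) Y := by
  have hM : ∀ (m : ℕ), (freeGenerator p q fun Y : Fin m → ℤ => contourIntegral r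
      (wave p q x (fun ξ => symmFactor ξ * (∑ i, eps p q (ξ i)) ^ k) Y))
      = fun Y => contourIntegral r
        (wave p q x (fun ξ => symmFactor ξ * (∑ i, eps p q (ξ i)) ^ (k + 1)) Y) := fun m => by
    ext Z
    have hc : ContinuousOn (fun ξ : Fin m → ℂ => symmFactor ξ * (∑ i, eps p q (ξ i)) ^ k)
        (torus r m) :=
      (continuousOn_symmFactor hr.2.1 m).mul ((continuousOn_sum_eps hr.1 p q m).pow k)
    rw [freeGenerator_contourIntegral_wave hpq hr x hc]
    simp only [pow_succ, mul_assoc]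
  unfold momentSum
  rw [freeGenerator_linear_combination, freeGenerator_removalSum, hM, hM]

theorem iterate_generatorFun_eq_momentSum {p q r : ℝ} (hp : 0 ≤ p) (hq : 0 ≤ q) (hpq : p + q = 1)
    (hp0 : p ≠ 0) (hr : SmallRadius p q r) (x : ℤ) {n : ℕ} (k : ℕ) (Y : Config (n + 2)) :
    (((generatorFun p q)^[k] (fun Z : Config (n + 2) => if Z.1 1 = x then 1 else 0) Y : ℝ) : ℂ)
      = momentSum p q r x k Y.1 := by
  induction k generalizing Y with
  | zero =>
    rw [momentSum_zero hp hq hpq hp0 hr, Function.iterate_zero, id]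
    split_ifs <;> simp
  | succ k ih =>
    rw [Function.iterate_succ_apply', generatorFun]
    push_cast
    simp only [ih]
    rw [sum_jump_eq_freeGenerator hpq (boundaryCondition_momentSum hpq hp0 hr x k),
      freeGenerator_momentSum hpq hr]

theorem hasSum_contourIntegral_integrand {p q r : ℝ} (hr : SmallRadius p q r) (t : ℝ) (x : ℤ)
    {n : ℕ} (Y : Fin n → ℤ) :
    HasSum (fun k : ℕ => (t : ℂ) ^ k / k.factorial * contourIntegral r
        (wave p q x (fun ξ => symmFactor ξ * (∑ i, eps p q (ξ i)) ^ k) Y))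
      (contourIntegral r (integrand p q t x Y)) := by
  have h := hasSum_contourIntegral_exp hr.1
    (continuousOn_wave hr x (continuousOn_symmFactor hr.2.1 n) Y)
    (continuousOn_sum_eps hr.1 p q n) t
  have e1 : integrand p q t x Y = fun ξ => wave p q x symmFactor Y ξ *
      Complex.exp ((∑ i, eps p q (ξ i)) * t) := funext fun ξ => integrand_eq_wave_mul_exp ..
  have e2 : ∀ k : ℕ, wave p q x (fun ξ => symmFactor ξ * (∑ i, eps p q (ξ i)) ^ k) Y
      = fun ξ => wave p q x symmFactor Y ξ * (∑ i, eps p q (ξ i)) ^ k := fun k => by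
    ext ξ
    simp only [wave]
    ring
  rw [e1]
  simp only [e2]
  exact h

theorem hasSum_momentSum {p q r : ℝ} (hr : SmallRadius p q r) (t : ℝ) (x : ℤ) {n : ℕ}
    (Y : Fin (n + 2) → ℤ) :
    HasSum (fun k : ℕ => (t : ℂ) ^ k / k.factorial * momentSum p q r x k Y)
      (-(q : ℂ) * bracket p q (n + 1) * (p : ℂ) ^ ((n + 1) * n / 2)
          * contourIntegral r (integrand p q t x Y)
        + (p : ℂ) ^ ((n + 1) * n / 2) * ∑ k : Fin (n + 2), ((q : ℂ) / p) ^ (k : ℕ)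
            * contourIntegral r (integrand p q t x (Y ∘ k.succAbove))) := by
  have h1 := (hasSum_contourIntegral_integrand hr t x Y).mul_left
    (-(q : ℂ) * bracket p q (n + 1) * (p : ℂ) ^ ((n + 1) * n / 2))
  have h2 := (hasSum_sum fun (k : Fin (n + 2)) (_ : k ∈ Finset.univ) =>
    (hasSum_contourIntegral_integrand hr t x (Y ∘ k.succAbove)).mul_left
      (((q : ℂ) / p) ^ (k : ℕ))).mul_left ((p : ℂ) ^ ((n + 1) * n / 2))
  refine (h1.add h2).congr_fun fun k => ?_
  simp only [momentSum, removalSum, Finset.mul_sum, mul_add]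
  congr 1
  · ring
  · exact Finset.sum_congr rfl fun i _ => by ring

/-! ### Semigroup series and the law of the process -/

theorem hasSum_semigroup (N : ℕ) (p q : ℝ) (t : ℝ≥0) (f : Config N →ᵇ ℝ) (Y : Config N) :
    HasSum (fun k : ℕ => (t : ℝ) ^ k / k.factorial * (generatorFun p q)^[k] f Y)
      (semigroup N p q t f Y) := by
  have h := NormedSpace.exp_series_hasSum_exp' (𝕂 := ℝ) ((t : ℝ) • generator N p q)
  have h1 := ((BoundedContinuousFunction.evalCLM ℝ Y).comp
    (ContinuousLinearMap.apply ℝ (Config N →ᵇ ℝ) f)).hasSum h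
  have hit : ∀ k : ℕ, ⇑((generator N p q ^ k) f) = (generatorFun p q)^[k] f := by
    intro k
    induction k with
    | zero => simp
    | succ k ih =>
      rw [pow_succ', Function.iterate_succ_apply', ← ih]
      rfl
  have hpow : ∀ k : ℕ, (((t : ℝ) • generator N p q) ^ k) f
      = (t : ℝ) ^ k • (generator N p q ^ k) f := by
    intro k
    induction k with
    | zero => simp
    | succ k ih =>
      rw [pow_succ' _ k, pow_succ' (generator N p q) k, pow_succ' (t : ℝ) k, mul_smul]
      change (t : ℝ) • generator N p q ((((t : ℝ) • generator N p q) ^ k) f) = _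
      rw [ih, map_smul]
      rfl
  refine (h1.congr_fun fun k => ?_)
  rw [← hit]
  simp [hpow]
  ring

/-- The bounded function attached to a set of configurations. -/
noncomputable def indicatorBCF {N : ℕ} (S : Set (Config N)) : Config N →ᵇ ℝ :=
  BoundedContinuousFunction.ofNormedAddCommGroupDiscrete (S.indicator 1) 1 fun X => by
    by_cases h : X ∈ S <;> simp [h]

/-- Expectations are taken in the Markov property with `s = 0`, where the process is almost surely
at `Y`. -/
theorem measureReal_eq_semigroup {Ω : Type*} [MeasurableSpace Ω] {μ : Measure Ω}
    [IsProbabilityMeasure μ] {N : ℕ} {p q : ℝ} {Y : Config N} {X : ℝ≥0 → Ω → Config N}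
    (hX : IsASEP μ p q Y X) (t : ℝ≥0) {S : Set (Config N)} (hS : MeasurableSet S) :
    μ.real {ω | X t ω ∈ S} = semigroup N p q t (indicatorBCF S) Y := by
  have hm := hX.markov 0 t (indicatorBCF S)
  rw [zero_add] at hm
  have hle : (⨆ u : Set.Iic (0 : ℝ≥0), MeasurableSpace.comap (X u) inferInstance)
      ≤ (inferInstance : MeasurableSpace Ω) :=
    iSup_le fun u => (hX.measurable u).comap_le
  have h1 := integral_condExp (μ := μ) hle (f := fun ω => indicatorBCF S (X t ω))
  rw [integral_congr_ae hm] at h1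
  have h2 : (fun ω => semigroup N p q t (indicatorBCF S) (X 0 ω))
      =ᵐ[μ] fun _ => semigroup N p q t (indicatorBCF S) Y := by
    filter_upwards [hX.initial] with ω hω
    rw [hω]
  rw [integral_congr_ae h2] at h1
  have h3 : (fun ω => indicatorBCF S (X t ω)) = (X t ⁻¹' S).indicator 1 := rfl
  rw [h3, integral_indicator_one ((hX.measurable t) hS)] at h1
  rw [integral_const, probReal_univ, one_smul] at h1
  exact h1.symm

end ASEP

theorem theorem4p1 {Ω : Type*} [MeasurableSpace Ω] (μ : Measure Ω) [IsProbabilityMeasure μ]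
    (N : ℕ) (hN : 2 ≤ N) (p q : ℝ) (hp : 0 ≤ p) (hq : 0 ≤ q) (hpq : p + q = 1) (hp0 : p ≠ 0)
    (Y : ASEP.Config N) (X : ℝ≥0 → Ω → ASEP.Config N) (hX : ASEP.IsASEP μ p q Y X)
    (r : ℝ) (hr : ASEP.SmallRadius p q r) (t : ℝ≥0) (x : ℤ) :
    ((μ.real {ω | (X t ω).1 ⟨1, hN⟩ = x} : ℝ) : ℂ) =
      -(q : ℂ) * ASEP.bracket p q (N - 1) * (p : ℂ) ^ ((N - 1) * (N - 2) / 2)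
          * ASEP.contourIntegral r (ASEP.integrand p q t x Y.1)
        + (p : ℂ) ^ ((N - 1) * (N - 2) / 2)
          * ∑ k : Fin N, ((q : ℂ) / p) ^ (k : ℕ)
            * ASEP.contourIntegral r (ASEP.integrand p q t x (ASEP.remove Y.1 k)) := by
  obtain ⟨n, rfl⟩ := Nat.exists_eq_add_of_le' hN
  have hS : MeasurableSet {Z : ASEP.Config (n + 2) | Z.1 1 = x} :=
    measurableSet_eq_fun ((measurable_pi_apply 1).comp measurable_subtype_coe) measurable_const
  have h1 := ASEP.measureReal_eq_semigroup hX t hS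
  have h2 := ASEP.hasSum_semigroup (n + 2) p q t
    (ASEP.indicatorBCF {Z : ASEP.Config (n + 2) | Z.1 1 = x}) Y
  rw [← h1] at h2
  have h3 := Complex.hasSum_ofReal.2 h2
  have hf : ⇑(ASEP.indicatorBCF {Z : ASEP.Config (n + 2) | Z.1 1 = x})
      = fun Z : ASEP.Config (n + 2) => if Z.1 1 = x then (1 : ℝ) else 0 := by
    ext Z
    simp [ASEP.indicatorBCF, Set.indicator_apply]
  have hk : ∀ k : ℕ, (((t : ℝ) ^ k / k.factorial * (ASEP.generatorFun p q)^[k]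
      (ASEP.indicatorBCF {Z : ASEP.Config (n + 2) | Z.1 1 = x}) Y : ℝ) : ℂ)
      = ((t : ℝ) : ℂ) ^ k / k.factorial * ASEP.momentSum p q r x k Y.1 := fun k => by
    rw [hf, Complex.ofReal_mul, ASEP.iterate_generatorFun_eq_momentSum hp hq hpq hp0 hr]
    push_cast
    rfl
  simp only [hk] at h3
  have h5 := h3.unique (ASEP.hasSum_momentSum hr t x Y.1)
  simp only [ASEP.remove_eq_comp_succAbove]
  -- With `N = n + 2`, the subtractions `N - 1` and `N - 2` reduce definitionally to `n + 1` and
  -- `n`.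
  exact h5
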